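/- Fix an integer $d\ge 1$ and let $\mathcal X_d=\{\langle k,i\rangle : k\ge 0,\ 1\le i\le d\}$, with levels $\ell_k=\{\langle k,1\rangle,\dots,\langle k,d\rangle\}$. A block lower Hessenberg branching process (block LHBP) $\{\boldsymbol Z_n\}$ is a multitype Galton–Watson process with type set $\mathcal X_d$, started by one individual, in which each individual lives for one generation and an individual of type $j$ has, independently of all the others, an offspring vector $\boldsymbol r\in\mathbb N_0^{\mathcal X_d}$ with distribution $p_j$, where for $j\in\ell_k$ the distribution $p_j$ is carried by the vectors without offspring in levels $>k+1$. For $d=1$ it is called an LHBP (with types $0,1,2,\dots$). Let $G_j(\boldsymbol s)=\sum_{\boldsymbol r}p_j(\boldsymbol r)\prod_{x}s_x^{r_x}$, $S=\{\boldsymbol s\in[0,1]^{\mathcal X_d}:\boldsymbol s=\boldsymbol G(\boldsymbol s)\}$ and $S_k=\{(s_j)_{j\in\ell_k}:\boldsymbol s\in S\}$. Let $q_j$ be the probability, starting from one individual of type $j$, that the whole population eventually dies out, and $\tilde q_j$ the probability that, for every $k$, the types of level at most $k$ eventually disappear for good. The process is irreducible if the directed graph on the types with an edge $i\to j$ whenever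 the mean number of type-$j$ children of a type-$i$ individual is positive has a path between any two types; it is singular if every individual has exactly one child with probability one. The process $\{\boldsymbol Z_n\}$ is locally isomorphic to an LHBP $\{\hat{\boldsymbol Z}_n\}$ with offspring distributions $(\hat p_k)_{k\ge0}$ if for every $k\ge 0$, every $j\in\ell_k$ and every $\boldsymbol u$, \[ \hat p_k(\boldsymbol u)=\sum_{\boldsymbol r\,:\ \sum_{x\in\ell_i}r_x=u_i\ \forall i}p_j(\boldsymbol r). \] Suppose that $\{\boldsymbol Z_n\}$ is locally isomorphic to an irreducible LHBP $\{\hat{\boldsymbol Z}_n\}$. Then: 1. $\boldsymbol q=\min S$, for the componentwise order; 2. if $\{\boldsymbol Z_n\}$ is irreducible, if $\{\hat{\boldsymbol Z}_n\}$ is non-singular or $\tilde{\boldsymbol q}=\boldsymbol 1$, and if $S\neq\{\boldsymbol 1\}$, then $\tilde{\boldsymbol q}=\sup\,(S\setminus\{\boldsymbol 1\})$, the componentwise supremum; 3. for every $k\ge 0$, $q_{\langle k,1\rangle}=\dots=q_{\langle k,d\rangle}$ and $\tilde q_{\langle k,1\rangle}=\dots=\tilde q_{\langle k,d\rangle}$,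 and \[ \bigl(x\,q_{\langle k,1\rangle}+(1-x)\,\tilde q_{\langle k,1\rangle}\bigr)\boldsymbol 1_d\in S_k\qquad\text{for all }x\in[0,1]. \] -/

import Mathlib

open MeasureTheory
open scoped ENNReal

noncomputable section

/-- The type set `{⟨k, i⟩ : k ≥ 0, i a phase}`; levels are the first, phases the second
coordinate (phases are numbered `0, …, d - 1`). -/
abbrev TypeSet (d : ℕ) : Type := ℕ × Fin d

/-- Offspring vectors. An individual of level `k` only has offspring in the finitely many types
of level at most `k + 1`, so every offspring vector is finitely supported. -/
abbrev OffspringVec (d : ℕ) : Type := TypeSet d →₀ ℕ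

instance instMeasurableSpaceOffspringVec (d : ℕ) : MeasurableSpace (OffspringVec d) := ⊤

/-- The offspring distributions of a block lower Hessenberg branching process with `d` phases.
A (single-phase) lower Hessenberg branching process is the case `d = 1`. -/
structure BlockLHBP (d : ℕ) where
  /-- `law j` is the offspring distribution of individuals of type `j`. -/
  law : TypeSet d → PMF (OffspringVec d)
  lowerHessenberg : ∀ j, ∀ r ∈ (law j).support, ∀ x : TypeSet d, j.1 + 1 < x.1 → r x = 0

/-- A virtual individual: the type of the root, and the line of descent, the most recent entry
first; the entry `(i, j)` stands for the child of type `j` with number `i` (from `0` on). -/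
abbrev VirtualIndividual (d : ℕ) : Type := TypeSet d × List (ℕ × TypeSet d)

/-- The type of a virtual individual. -/
def typeOf {d : ℕ} : VirtualIndividual d → TypeSet d
  | (root, []) => root
  | (_, (_, j) :: _) => j

/-- The Ulam–Harris space: an outcome assigns an offspring vector to each virtual individual. -/
abbrev Outcome (d : ℕ) : Type := VirtualIndividual d → OffspringVec d

/-- The individual with the given line of descent appears in the population started by one
individual of type `root`. -/
def Appears {d : ℕ} (ω : Outcome d) (root : TypeSet d) : List (ℕ × TypeSet d) → Prop
  | [] => True
  | (i, j) :: l => Appears ω root l ∧ i < ω (root, l) j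

/-- The number of individuals of type `j` in generation `n`. -/
def population {d : ℕ} (ω : Outcome d) (root : TypeSet d) (n : ℕ) (j : TypeSet d) : ℕ∞ :=
  Set.encard {l : List (ℕ × TypeSet d) |
    l.length = n ∧ Appears ω root l ∧ typeOf (root, l) = j}

/-- The event of eventual extinction in the set of types `A`. -/
def extinctionEvent {d : ℕ} (root : TypeSet d) (A : Set (TypeSet d)) : Set (Outcome d) :=
  {ω | ∃ n : ℕ, ∀ m ≥ n, ∀ j ∈ A, population ω root m j = 0}

namespace BlockLHBP

variable {d : ℕ}

/-- The probability measure on the Ulam–Harris space: the offspring vectors of all virtual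
individuals are independent, that of an individual of type `j` having distribution `law j`. -/
def prob (p : BlockLHBP d) : Measure (Outcome d) :=
  Measure.infinitePi fun v : VirtualIndividual d => (p.law (typeOf v)).toMeasure

/-- The global extinction probability vector `q`. -/
def globalExtinction (p : BlockLHBP d) (j : TypeSet d) : ℝ :=
  p.prob.real (extinctionEvent j Set.univ)

/-- The partial extinction probability vector `q̃`: for every `k`, the types of level at most `k`
eventually disappear. -/
def partialExtinction (p : BlockLHBP d) (j : TypeSet d) : ℝ :=
  p.prob.real (⋂ k : ℕ, extinctionEvent j {x | x.1 ≤ k})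

/-- The progeny generating function. -/
def progenyGF (p : BlockLHBP d) (s : TypeSet d → ℝ) (j : TypeSet d) : ℝ :=
  ∑' r : OffspringVec d, (p.law j r).toReal * r.prod fun x n => s x ^ n

/-- The set `S` of fixed points of the progeny generating function in `[0,1]^𝒳`. -/
def fixedPoints (p : BlockLHBP d) : Set (TypeSet d → ℝ) :=
  {s | (∀ j, s j ∈ Set.Icc (0 : ℝ) 1) ∧ s = p.progenyGF s}

/-- The projection `S_k` of `S` onto level `k`. -/
def levelProjection (p : BlockLHBP d) (k : ℕ) : Set (Fin d → ℝ) :=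
  {u | (∀ i, u i ∈ Set.Icc (0 : ℝ) 1) ∧ ∃ s ∈ p.fixedPoints, ∀ i, s (k, i) = u i}

/-- The mean progeny matrix (its entries may be infinite). -/
def meanProgeny (p : BlockLHBP d) (i j : TypeSet d) : ℝ≥0∞ :=
  ∑' r : OffspringVec d, p.law i r * (r j : ℝ≥0∞)

/-- There is a path between any two vertices of the mean progeny representation graph. -/
def Irreducible (p : BlockLHBP d) : Prop :=
  ∀ i j, Relation.ReflTransGen (fun a b => 0 < p.meanProgeny a b) i j

/-- Each individual has exactly one child with probability one. -/
def Singular (p : BlockLHBP d) : Prop :=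
  ∀ j, ∀ r ∈ (p.law j).support, (r.sum fun _ n => n) = 1

/-- The block process `p` is locally isomorphic to the single-phase process `phat`: summing an
offspring vector of a type of level `k` over the phases of each level gives an offspring
vector distributed as that of type `k` in `phat`. -/
def LocallyIsomorphic (p : BlockLHBP d) (phat : BlockLHBP 1) : Prop :=
  ∀ (k : ℕ) (i : Fin d) (u : OffspringVec 1),
    phat.law (k, 0) u =
      ∑' r : {r : OffspringVec d // ∀ l : ℕ, ∑ a : Fin d, r (l, a) = u (l, 0)}, p.law (k, i) r

end BlockLHBP

end

/-!
Extinction probabilities are monotone limits of iterates of the generating function and of its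
stopped versions, so everything takes place among monotone, continuous operators on `[0,1]^X` that
are convex along ordered segments. The iterates that define `q` stay below every fixed point.

Kill the process when it leaves a set of types `A`, and let `u` be the weight of an individual that
has just left. The resulting generating function is convex and lower semicontinuous in `u`, lies
below `q` at `u = 0` and above the extinction probability of `A` at `u = 1`, and solves the fixed
point equation on `A`; hence it takes all values in between. Letting `A` exhaust the types,
compactness gives a fixed point with any prescribed value between `q` and `q̃` at a given type.

Let the process be irreducible, `s ≠ 1` a fixed point and `v ≠ 1` the extinction vector of a finite
set `A`. A bound `s ≤ (1 - t) v + t` on `A` extends to all types. If the least such `t` were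
positive, then equality at one type would propagate to all of them, and strict convexity would leave
each individual with at most one child, which forces the process to be singular. Hence `s ≤ v`.

Under a local isomorphism, forgetting the phases turns the block process into the single-phase one,
so that extinction probabilities and fixed points of the latter lift to vectors constant on levels.
-/

noncomputable section

open Filter Set Topology

lemma exists_eq_of_convexOn_of_lowerSemicontinuousOn {φ : ℝ → ℝ} {a b x : ℝ} (hab : a ≤ b)
    (hconvex : ConvexOn ℝ (Icc a b) φ) (hlsc : LowerSemicontinuousOn φ (Icc a b))
    (ha : φ a ≤ x) (hb : x ≤ φ b) : ∃ u ∈ Icc a b, φ u = x := by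
  obtain ⟨u, ⟨huI, hux⟩, hmax⟩ :=
    (hlsc.isCompact_inter_preimage_Iic isCompact_Icc x).exists_isGreatest
      ⟨a, left_mem_Icc.2 hab, ha⟩
  refine ⟨u, huI, hux.antisymm (not_lt.1 fun hlt => ?_)⟩
  have hub : u < b := huI.2.lt_of_ne (by rintro rfl; exact hb.not_gt hlt)
  have hpos : 0 < φ b - φ u := by linarith
  -- On the chord from `u` to `b` the value `x` is taken at a point beyond `u`.
  set t := (x - φ u) / (φ b - φ u) with ht
  have ht0 : 0 < t := div_pos (sub_pos.2 hlt) hpos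
  have ht1 : t ≤ 1 := (div_le_one hpos).2 (by linarith)
  have hchord := hconvex.2 huI (right_mem_Icc.2 hab) (sub_nonneg.2 ht1) ht0.le (by ring)
  have hx : (1 - t) • φ u + t • φ b = x := by
    simp only [smul_eq_mul, ht]
    field_simp
    ring
  have hle := hmax ⟨hconvex.1 huI (right_mem_Icc.2 hab) (sub_nonneg.2 ht1) ht0.le (by ring),
    hchord.trans_eq hx⟩
  simp only [smul_eq_mul] at hle
  nlinarith [mul_pos ht0 (sub_pos.2 hub)]

section Monomial

variable {X : Type*} {s f g : X → ℝ}

/-- The monomial `∏ x, s x ^ r x`, the contribution of the offspring vector `r` to a generating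
function at `s`. -/
def evalMonomial (s : X → ℝ) (r : X →₀ ℕ) : ℝ := r.prod fun x n => s x ^ n

@[simp] lemma evalMonomial_zero (s : X → ℝ) : evalMonomial s 0 = 1 :=
  Finsupp.prod_zero_index

lemma evalMonomial_add (s : X → ℝ) (r r' : X →₀ ℕ) :
    evalMonomial s (r + r') = evalMonomial s r * evalMonomial s r' :=
  Finsupp.prod_add_index' (fun _ => pow_zero _) fun _ _ _ => pow_add _ _ _

@[simp] lemma evalMonomial_single (s : X → ℝ) (x : X) (n : ℕ) :
    evalMonomial s (Finsupp.single x n) = s x ^ n :=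
  Finsupp.prod_single_index (pow_zero _)

@[simp] lemma evalMonomial_one (r : X →₀ ℕ) : evalMonomial 1 r = 1 := by
  simp [evalMonomial, Finsupp.prod]

lemma evalMonomial_const (c : ℝ) (r : X →₀ ℕ) : evalMonomial (fun _ => c) r = c ^ r.degree :=
  Finset.prod_pow_eq_pow_sum _ _ _

lemma evalMonomial_single_add (s : X → ℝ) (x : X) (r : X →₀ ℕ) :
    evalMonomial s (Finsupp.single x 1 + r) = s x * evalMonomial s r := by
  rw [evalMonomial_add, evalMonomial_single, pow_one]

lemma evalMonomial_mapDomain {Y : Type*} (π : X → Y) (s : Y → ℝ) (r : X →₀ ℕ) :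
    evalMonomial s (r.mapDomain π) = evalMonomial (s ∘ π) r :=
  Finsupp.prod_mapDomain_index (fun _ => pow_zero _) fun _ _ _ => pow_add _ _ _

lemma continuous_evalMonomial (r : X →₀ ℕ) : Continuous fun s => evalMonomial s r :=
  continuous_finsetProd _ fun x _ => (continuous_apply x).pow _

lemma exists_ne_zero_of_degree_pos {r : X →₀ ℕ} (h : 0 < r.degree) : ∃ x, r x ≠ 0 := by
  by_contra! h0
  exact h.ne' ((Finsupp.degree_eq_zero_iff r).2 (Finsupp.ext h0))

lemma exists_eq_single_add {r : X →₀ ℕ} {x : X} (h : r x ≠ 0) :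
    ∃ r', r = Finsupp.single x 1 + r' :=
  ⟨r - Finsupp.single x 1, (add_tsub_cancel_of_le
    (Finsupp.single_le_iff.2 (Nat.one_le_iff_ne_zero.2 h))).symm⟩

@[elab_as_elim]
lemma single_add_induction {motive : (X →₀ ℕ) → Prop} (r : X →₀ ℕ) (zero : motive 0)
    (single_add : ∀ x r, motive r → motive (Finsupp.single x 1 + r)) : motive r := by
  induction hn : r.degree generalizing r with
  | zero => rwa [(Finsupp.degree_eq_zero_iff r).1 hn]
  | succ n ih =>
    obtain ⟨x, hx⟩ := exists_ne_zero_of_degree_pos (r := r) (by omega)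
    obtain ⟨r', rfl⟩ := exists_eq_single_add hx
    rw [map_add, Finsupp.degree_single] at hn
    exact single_add x r' (ih r' (by omega))

lemma evalMonomial_mem_Icc (hs : s ∈ Icc 0 1) (r : X →₀ ℕ) :
    evalMonomial s r ∈ Icc (0 : ℝ) 1 :=
  ⟨Finset.prod_nonneg fun x _ => pow_nonneg (hs.1 x) _,
    Finset.prod_le_one (fun x _ => pow_nonneg (hs.1 x) _) fun x _ => pow_le_one₀ (hs.1 x) (hs.2 x)⟩

lemma evalMonomial_pos (hs : ∀ x, 0 < s x) (r : X →₀ ℕ) : 0 < evalMonomial s r :=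
  Finset.prod_pos fun x _ => pow_pos (hs x) _

lemma evalMonomial_mono (hf : 0 ≤ f) (hfg : f ≤ g) (r : X →₀ ℕ) :
    evalMonomial f r ≤ evalMonomial g r :=
  Finset.prod_le_prod (fun x _ => pow_nonneg (hf x) _) fun x _ => pow_le_pow_left₀ (hf x) (hfg x) _

lemma evalMonomial_le_apply (hs : s ∈ Icc 0 1) {r : X →₀ ℕ} {x : X} (hx : r x ≠ 0) :
    evalMonomial s r ≤ s x := by
  obtain ⟨r', rfl⟩ := exists_eq_single_add hx
  rw [evalMonomial_single_add]
  exact mul_le_of_le_one_right (hs.1 x) (evalMonomial_mem_Icc hs r').2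

lemma evalMonomial_segment_le (hf : 0 ≤ f) (hfg : f ≤ g) {a b : ℝ} (ha : 0 ≤ a) (hb : 0 ≤ b)
    (hab : a + b = 1) (r : X →₀ ℕ) :
    evalMonomial (a • f + b • g) r ≤ a * evalMonomial f r + b * evalMonomial g r := by
  induction r using single_add_induction with
  | zero => simp [hab]
  | single_add x r ih =>
    simp only [evalMonomial_single_add, Pi.add_apply, Pi.smul_apply, smul_eq_mul]
    have hx : 0 ≤ a * f x + b * g x :=
      add_nonneg (mul_nonneg ha (hf x)) (mul_nonneg hb ((hf x).trans (hfg x)))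
    have hcross : 0 ≤ a * b * ((g x - f x) * (evalMonomial g r - evalMonomial f r)) :=
      mul_nonneg (mul_nonneg ha hb)
        (mul_nonneg (sub_nonneg.2 (hfg x)) (sub_nonneg.2 (evalMonomial_mono hf hfg r)))
    obtain rfl := eq_sub_of_add_eq hab
    linear_combination mul_le_mul_of_nonneg_left ih hx + hcross

lemma evalMonomial_segment_one_lt (hs : s ∈ Icc 0 1) (hs1 : ∀ x, s x < 1) {a b : ℝ} (ha : 0 < a)
    (hb : 0 < b) (hab : a + b = 1) {r : X →₀ ℕ} (hr : 1 < r.degree) :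
    evalMonomial (a • s + b • 1) r < a * evalMonomial s r + b := by
  obtain ⟨x, hx⟩ := exists_ne_zero_of_degree_pos (zero_lt_one.trans hr)
  obtain ⟨r, rfl⟩ := exists_eq_single_add hx
  obtain ⟨y, hy⟩ := exists_ne_zero_of_degree_pos (r := r) (by simpa using hr)
  have hlt : evalMonomial s r < 1 := (evalMonomial_le_apply hs hy).trans_lt (hs1 y)
  have hle := evalMonomial_segment_le hs.1 hs.2 ha.le hb.le hab r
  simp only [evalMonomial_single_add, evalMonomial_one, Pi.add_apply, Pi.smul_apply, smul_eq_mul,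
    Pi.one_apply, mul_one] at hle ⊢
  have hx : 0 ≤ a * s x + b := add_nonneg (mul_nonneg ha.le (hs.1 x)) hb.le
  have hcross : 0 < a * b * ((1 - s x) * (1 - evalMonomial s r)) :=
    mul_pos (mul_pos ha hb) (mul_pos (sub_pos.2 (hs1 x)) (sub_pos.2 hlt))
  obtain rfl := eq_sub_of_add_eq hab
  linear_combination mul_le_mul_of_nonneg_left hle hx + hcross

lemma eq_of_evalMonomial_eq (hf : 0 ≤ f) (hfg : f ≤ g) (hg : ∀ x, 0 < g x) {r : X →₀ ℕ}
    (h : evalMonomial f r = evalMonomial g r) {x : X} (hx : r x ≠ 0) : f x = g x := by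
  obtain ⟨r', rfl⟩ := exists_eq_single_add hx
  rw [evalMonomial_single_add, evalMonomial_single_add] at h
  refine (hfg x).antisymm (le_of_mul_le_mul_right ?_ (evalMonomial_pos hg r'))
  exact h.ge.trans (mul_le_mul_of_nonneg_left (evalMonomial_mono hf hfg r') (hf x))

end Monomial

section Expectation

variable {α β : Type*} (μ : PMF α) {a b : α → ℝ}

lemma hasSum_toReal_pmf : HasSum (fun x => (μ x).toReal) 1 := by
  simpa [← ENNReal.tsum_toReal_eq μ.apply_ne_top, μ.tsum_coe]
    using ENNReal.hasSum_toReal μ.tsum_coe_ne_top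

lemma summable_toReal_pmf_mul (ha : ∀ x, a x ∈ Icc (0 : ℝ) 1) :
    Summable fun x => (μ x).toReal * a x :=
  (hasSum_toReal_pmf μ).summable.of_nonneg_of_le
    (fun x => mul_nonneg ENNReal.toReal_nonneg (ha x).1)
    fun x => mul_le_of_le_one_right ENNReal.toReal_nonneg (ha x).2

lemma tsum_toReal_mul_add (ha : ∀ x, a x ∈ Icc (0 : ℝ) 1) (hb : ∀ x, b x ∈ Icc (0 : ℝ) 1)
    (c d : ℝ) :
    ∑' x, (μ x).toReal * (c * a x + d * b x) =
      c * ∑' x, (μ x).toReal * a x + d * ∑' x, (μ x).toReal * b x := by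
  rw [← tsum_mul_left, ← tsum_mul_left, ← Summable.tsum_add
    ((summable_toReal_pmf_mul μ ha).mul_left c) ((summable_toReal_pmf_mul μ hb).mul_left d)]
  exact tsum_congr fun x => by ring

lemma eq_on_support_of_tsum_le (ha : ∀ x, a x ∈ Icc (0 : ℝ) 1) (hb : ∀ x, b x ∈ Icc (0 : ℝ) 1)
    (hab : ∀ x ∈ μ.support, a x ≤ b x)
    (h : ∑' x, (μ x).toReal * b x ≤ ∑' x, (μ x).toReal * a x) :
    ∀ x ∈ μ.support, a x = b x := by
  intro x hx
  have hle : ∀ y, (μ y).toReal * a y ≤ (μ y).toReal * b y := fun y => by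
    by_cases hy : y ∈ μ.support
    · exact mul_le_mul_of_nonneg_left (hab y hy) ENNReal.toReal_nonneg
    · simp [(μ.apply_eq_zero_iff y).2 hy]
  have hpos : 0 < (μ x).toReal :=
    ENNReal.toReal_pos ((μ.mem_support_iff x).1 hx) (μ.apply_ne_top x)
  refine (hab x hx).eq_of_not_lt fun hlt => h.not_gt ?_
  exact Summable.tsum_lt_tsum hle (mul_lt_mul_of_pos_left hlt hpos)
    (summable_toReal_pmf_mul μ ha) (summable_toReal_pmf_mul μ hb)

lemma le_tsum_toReal_mul {c : ℝ} (ha : ∀ x, a x ∈ Icc (0 : ℝ) 1) (h : ∀ x ∈ μ.support, c ≤ a x) :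
    c ≤ ∑' x, (μ x).toReal * a x := by
  refine hasSum_le (fun x => ?_) (by simpa using (hasSum_toReal_pmf μ).mul_right c)
    (summable_toReal_pmf_mul μ ha).hasSum
  by_cases hx : x ∈ μ.support
  · exact mul_le_mul_of_nonneg_left (h x hx) ENNReal.toReal_nonneg
  · simp [(μ.apply_eq_zero_iff x).2 hx]

lemma tsum_map_toReal_mul (π : α → β) (b : β → ℝ) (hb : ∀ y, b y ∈ Icc (0 : ℝ) 1) :
    ∑' y, ((μ.map π) y).toReal * b y = ∑' x, (μ x).toReal * b (π x) := by
  let _ : MeasurableSpace α := ⊤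
  let _ : MeasurableSpace β := ⊤
  have hint : ∀ (ν : PMF β), Integrable b ν.toMeasure := fun ν =>
    Integrable.of_mem_Icc 0 1 Measurable.of_discrete.aemeasurable (Eventually.of_forall hb)
  calc ∑' y, ((μ.map π) y).toReal * b y
      = ∫ y, b y ∂(μ.map π).toMeasure := (PMF.integral_eq_tsum _ _ (hint _)).symm
    _ = ∫ x, b (π x) ∂μ.toMeasure := by
        rw [← PMF.toMeasure_map π μ Measurable.of_discrete]
        exact integral_map Measurable.of_discrete.aemeasurable
          Measurable.of_discrete.aestronglyMeasurable
    _ = ∑' x, (μ x).toReal * b (π x) := PMF.integral_eq_tsum _ _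
        (Integrable.of_mem_Icc 0 1 Measurable.of_discrete.aemeasurable
          (Eventually.of_forall fun x => hb (π x)))

end Expectation

section GeneratingFunction

variable {X Y : Type*} (μ : PMF (X →₀ ℕ)) {s f g : X → ℝ}

/-- The probability generating function of the distribution `μ` of an offspring vector. -/
def pgf (s : X → ℝ) : ℝ := ∑' r, (μ r).toReal * evalMonomial s r

lemma summable_pgf (hs : s ∈ Icc 0 1) : Summable fun r => (μ r).toReal * evalMonomial s r :=
  summable_toReal_pmf_mul μ (evalMonomial_mem_Icc hs)

@[simp] lemma pgf_one : pgf μ 1 = 1 := by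
  simp [pgf, (hasSum_toReal_pmf μ).tsum_eq]

lemma pgf_mono (hf : f ∈ Icc 0 1) (hg : g ∈ Icc 0 1) (hfg : f ≤ g) : pgf μ f ≤ pgf μ g :=
  (summable_pgf μ hf).tsum_le_tsum
    (fun r => mul_le_mul_of_nonneg_left (evalMonomial_mono hf.1 hfg r) ENNReal.toReal_nonneg)
    (summable_pgf μ hg)

lemma pgf_mem_Icc (hs : s ∈ Icc 0 1) : pgf μ s ∈ Icc (0 : ℝ) 1 :=
  ⟨tsum_nonneg fun r => mul_nonneg ENNReal.toReal_nonneg (evalMonomial_mem_Icc hs r).1,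
    (pgf_mono μ hs (right_mem_Icc.2 zero_le_one) hs.2).trans_eq (pgf_one μ)⟩

lemma pgf_segment_le (hf : f ∈ Icc 0 1) (hg : g ∈ Icc 0 1) (hfg : f ≤ g) {a b : ℝ} (ha : 0 ≤ a)
    (hb : 0 ≤ b) (hab : a + b = 1) : pgf μ (a • f + b • g) ≤ a * pgf μ f + b * pgf μ g := by
  have hf' := evalMonomial_mem_Icc hf
  have hg' := evalMonomial_mem_Icc hg
  rw [pgf, pgf, pgf, ← tsum_toReal_mul_add μ hf' hg']
  exact (summable_pgf μ (convex_Icc 0 1 hf hg ha hb hab)).tsum_le_tsum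
    (fun r => mul_le_mul_of_nonneg_left (evalMonomial_segment_le hf.1 hfg ha hb hab r)
      ENNReal.toReal_nonneg)
    (summable_toReal_pmf_mul μ fun r => convex_Icc 0 1 (hf' r) (hg' r) ha hb hab)

lemma continuousOn_pgf : ContinuousOn (pgf μ) (Icc 0 1) :=
  continuousOn_tsum (fun r => (continuous_const.mul (continuous_evalMonomial r)).continuousOn)
    (hasSum_toReal_pmf μ).summable fun r s hs => by
      rw [norm_mul, Real.norm_of_nonneg ENNReal.toReal_nonneg,
        Real.norm_of_nonneg (evalMonomial_mem_Icc hs r).1]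
      exact mul_le_of_le_one_right ENNReal.toReal_nonneg (evalMonomial_mem_Icc hs r).2

lemma eq_of_pgf_le (hf : f ∈ Icc 0 1) (hg : g ∈ Icc 0 1) (hfg : f ≤ g) (hpos : ∀ x, 0 < g x)
    (h : pgf μ g ≤ pgf μ f) {r : X →₀ ℕ} (hr : r ∈ μ.support) {x : X} (hx : r x ≠ 0) :
    f x = g x :=
  eq_of_evalMonomial_eq hf.1 hfg hpos (eq_on_support_of_tsum_le μ (evalMonomial_mem_Icc hf)
    (evalMonomial_mem_Icc hg) (fun r _ => evalMonomial_mono hf.1 hfg r) h r hr) hx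

lemma degree_le_one_of_segment_one_le_pgf (hs : s ∈ Icc 0 1) (hs1 : ∀ x, s x < 1) {a b : ℝ}
    (ha : 0 < a) (hb : 0 < b) (hab : a + b = 1) (h : a * pgf μ s + b ≤ pgf μ (a • s + b • 1)) :
    ∀ r ∈ μ.support, r.degree ≤ 1 := by
  have h1 : (1 : X → ℝ) ∈ Icc 0 1 := right_mem_Icc.2 zero_le_one
  have hs' := evalMonomial_mem_Icc hs
  have h1' := evalMonomial_mem_Icc h1
  have hsum : ∑' r, (μ r).toReal * (a * evalMonomial s r + b * evalMonomial 1 r) =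
      a * pgf μ s + b := by
    rw [tsum_toReal_mul_add μ hs' h1', ← pgf, ← pgf, pgf_one, mul_one]
  intro r hr
  by_contra! hdegree
  refine (evalMonomial_segment_one_lt hs hs1 ha hb hab hdegree).ne ?_
  simpa using eq_on_support_of_tsum_le μ
    (evalMonomial_mem_Icc (convex_Icc 0 1 hs h1 ha.le hb.le hab))
    (fun r => convex_Icc 0 1 (hs' r) (h1' r) ha.le hb.le hab)
    (fun r _ => evalMonomial_segment_le hs.1 hs.2 ha.le hb.le hab r) (hsum.trans_le h) r hr

lemma le_pgf_const (hμ : ∀ r ∈ μ.support, r.degree ≤ 1) {c : ℝ} (hc : c ∈ Icc (0 : ℝ) 1) :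
    c ≤ pgf μ fun _ => c := by
  have hmem : (fun _ : X => c) ∈ Icc 0 1 := ⟨fun _ => hc.1, fun _ => hc.2⟩
  refine le_tsum_toReal_mul μ (evalMonomial_mem_Icc hmem) fun r hr => ?_
  rw [evalMonomial_const]
  exact (pow_one c).symm.trans_le (pow_le_pow_of_le_one hc.1 hc.2 (hμ r hr))

lemma pgf_map_mapDomain (π : X → Y) {t : Y → ℝ} (ht : t ∈ Icc 0 1) :
    pgf (μ.map (Finsupp.mapDomain π)) t = pgf μ (t ∘ π) := by
  simp only [pgf, tsum_map_toReal_mul μ _ _ (evalMonomial_mem_Icc ht), evalMonomial_mapDomain]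

end GeneratingFunction

section GeneratingOperator

variable {X : Type*} {T : (X → ℝ) → X → ℝ} {A : Set X} {f g : X → ℝ} {x : X}

/-- The properties shared by the progeny generating function and the operators derived from it,
with `[0,1]^X` encoded as the order interval `Icc 0 1`. Convexity is required along ordered segments
only: a monomial such as `s x * s y` is not convex on the cube. -/
structure IsGeneratingOperator (T : (X → ℝ) → X → ℝ) : Prop where
  mapsTo : MapsTo T (Icc 0 1) (Icc 0 1)
  monotoneOn : MonotoneOn T (Icc 0 1)
  continuousOn : ContinuousOn T (Icc 0 1)
  map_segment_le : ∀ ⦃f⦄, f ∈ Icc 0 1 → ∀ ⦃g⦄, g ∈ Icc 0 1 → f ≤ g → ∀ ⦃a b : ℝ⦄, 0 ≤ a → 0 ≤ b →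
    a + b = 1 → T (a • f + b • g) ≤ a • T f + b • T g
  map_one : T 1 = 1

open Classical in
/-- The operator `T` stopped on `A`: the coordinates in `A` are left unchanged. For a progeny
generating function this means that individuals of a type in `A` live forever. -/
def stopOn (A : Set X) (T : (X → ℝ) → X → ℝ) (f : X → ℝ) : X → ℝ := A.piecewise f (T f)

lemma stopOn_of_mem (T : (X → ℝ) → X → ℝ) (f : X → ℝ) (hx : x ∈ A) : stopOn A T f x = f x := by
  classical exact piecewise_eq_of_mem _ _ _ hx

lemma stopOn_of_notMem (T : (X → ℝ) → X → ℝ) (f : X → ℝ) (hx : x ∉ A) :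
    stopOn A T f x = T f x := by
  classical exact piecewise_eq_of_notMem _ _ _ hx

lemma iterate_stopOn_of_mem (T : (X → ℝ) → X → ℝ) (f : X → ℝ) (hx : x ∈ A) (n : ℕ) :
    (stopOn A T)^[n] f x = f x := by
  induction n with
  | zero => rfl
  | succ n ih => rw [Function.iterate_succ_apply', stopOn_of_mem _ _ hx, ih]

lemma stopOn_le_self (h : ∀ x ∉ A, T f x ≤ f x) : stopOn A T f ≤ f := by
  classical exact piecewise_le (fun _ _ => le_rfl) h

lemma le_stopOn_self (h : ∀ x ∉ A, f x ≤ T f x) : f ≤ stopOn A T f := by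
  classical exact le_piecewise (fun _ _ => le_rfl) h

namespace IsGeneratingOperator

protected lemma stopOn (hT : IsGeneratingOperator T) (A : Set X) :
    IsGeneratingOperator (stopOn A T) where
  mapsTo f hf := by
    classical
    exact piecewise_mem_Icc (fun x _ => ⟨hf.1 x, hf.2 x⟩)
      fun x _ => ⟨(hT.mapsTo hf).1 x, (hT.mapsTo hf).2 x⟩
  monotoneOn f hf g hg h := by
    classical
    exact piecewise_mono (fun x _ => h x) fun x _ => hT.monotoneOn hf hg h x
  continuousOn := continuousOn_pi.2 fun x => by
    by_cases hx : x ∈ A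
    · exact (continuous_apply x).continuousOn.congr fun f _ => stopOn_of_mem T f hx
    · exact (continuousOn_pi.1 hT.continuousOn x).congr fun f _ => stopOn_of_notMem T f hx
  map_segment_le f hf g hg h a b ha hb hab x := by
    by_cases hx : x ∈ A
    · simp [stopOn_of_mem, hx]
    · simpa [stopOn_of_notMem, hx] using hT.map_segment_le hf hg h ha hb hab x
  map_one := by
    simp only [stopOn, hT.map_one, piecewise_same]

lemma iterate (hT : IsGeneratingOperator T) (n : ℕ) : IsGeneratingOperator T^[n] := by
  induction n with
  | zero =>
    exact ⟨mapsTo_id _, monotoneOn_id, continuousOn_id, fun _ _ _ _ _ _ _ _ _ _ => le_rfl, rfl⟩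
  | succ n ih =>
    rw [Function.iterate_succ']
    refine ⟨hT.mapsTo.comp ih.mapsTo, hT.monotoneOn.comp ih.monotoneOn ih.mapsTo,
      hT.continuousOn.comp ih.continuousOn ih.mapsTo, fun f hf g hg h a b ha hb hab => ?_, ?_⟩
    · have hf' := ih.mapsTo hf
      have hg' := ih.mapsTo hg
      exact (hT.monotoneOn (ih.mapsTo (convex_Icc 0 1 hf hg ha hb hab))
        (convex_Icc 0 1 hf' hg' ha hb hab) (ih.map_segment_le hf hg h ha hb hab)).trans
        (hT.map_segment_le hf' hg' (ih.monotoneOn hf hg h) ha hb hab)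
    · rw [Function.comp_apply, ih.map_one, hT.map_one]

lemma iterate_le (hT : IsGeneratingOperator T) (hf : f ∈ Icc 0 1) (hg : g ∈ Icc 0 1) (hfg : f ≤ g)
    (h : T g ≤ g) (n : ℕ) : T^[n] f ≤ g := by
  induction n with
  | zero => exact hfg
  | succ n ih =>
    rw [Function.iterate_succ_apply']
    exact (hT.monotoneOn ((hT.iterate n).mapsTo hf) hg ih).trans h

lemma le_iterate (hT : IsGeneratingOperator T) (hf : f ∈ Icc 0 1) (hg : g ∈ Icc 0 1) (hgf : g ≤ f)
    (h : g ≤ T g) (n : ℕ) : g ≤ T^[n] f := by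
  induction n with
  | zero => exact hgf
  | succ n ih =>
    rw [Function.iterate_succ_apply']
    exact h.trans (hT.monotoneOn hg ((hT.iterate n).mapsTo hf) ih)

lemma mem_Icc_of_tendsto_iterate (hT : IsGeneratingOperator T) (hf : f ∈ Icc 0 1)
    (h : Tendsto (fun n => T^[n] f) atTop (𝓝 g)) : g ∈ Icc 0 1 :=
  isClosed_Icc.mem_of_tendsto h (Eventually.of_forall fun n => (hT.iterate n).mapsTo hf)

lemma map_eq_of_tendsto_iterate (hT : IsGeneratingOperator T) (hf : f ∈ Icc 0 1)
    (h : Tendsto (fun n => T^[n] f) atTop (𝓝 g)) : T g = g := by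
  have hg := hT.mem_Icc_of_tendsto_iterate hf h
  have hcomp : Tendsto (fun n => T (T^[n] f)) atTop (𝓝 (T g)) :=
    (hT.continuousOn g hg).tendsto.comp (tendsto_nhdsWithin_iff.2
      ⟨h, Eventually.of_forall fun n => (hT.iterate n).mapsTo hf⟩)
  refine tendsto_nhds_unique hcomp ?_
  simp only [← Function.iterate_succ_apply']
  exact h.comp (tendsto_add_atTop_nat 1)

lemma tendsto_iterate_iSup (hT : IsGeneratingOperator T) (hf : f ∈ Icc 0 1) (h : f ≤ T f) :
    Tendsto (fun n => T^[n] f) atTop (𝓝 (⨆ n, T^[n] f)) := by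
  refine tendsto_atTop_ciSup (monotone_nat_of_le_succ fun n => ?_)
    ⟨1, forall_mem_range.2 fun n => ((hT.iterate n).mapsTo hf).2⟩
  rw [Function.iterate_succ_apply]
  exact (hT.iterate n).monotoneOn hf (hT.mapsTo hf) h

lemma tendsto_iterate_iInf (hT : IsGeneratingOperator T) (hf : f ∈ Icc 0 1) (h : T f ≤ f) :
    Tendsto (fun n => T^[n] f) atTop (𝓝 (⨅ n, T^[n] f)) := by
  refine tendsto_atTop_ciInf (antitone_nat_of_succ_le fun n => ?_)
    ⟨0, forall_mem_range.2 fun n => ((hT.iterate n).mapsTo hf).1⟩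
  rw [Function.iterate_succ_apply]
  exact (hT.iterate n).monotoneOn (hT.mapsTo hf) hf h

lemma le_of_tendsto_iterate_of_le_segment (hT : IsGeneratingOperator T) {u v b : X → ℝ}
    (hv : v ∈ Icc 0 1) (hb : b ∈ Icc 0 1) (hvb : v ≤ b) (hTv : T v ≤ v)
    (hlim : Tendsto (fun n => T^[n] b) atTop (𝓝 u)) {c : ℝ} (hc : c ∈ Ico (0 : ℝ) 1)
    (h : u ≤ (1 - c) • v + c • b) : u ≤ v := by
  have hc' : 0 ≤ 1 - c := sub_nonneg.2 hc.2.le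
  have hu := hT.mem_Icc_of_tendsto_iterate hb hlim
  have hTu := hT.map_eq_of_tendsto_iterate hb hlim
  -- Iterating the bound `h` turns `b` into `u`.
  have hself : u ≤ (1 - c) • v + c • u := by
    refine ge_of_tendsto' ((hlim.const_smul c).const_add ((1 - c) • v)) fun n => ?_
    calc u ≤ T^[n] ((1 - c) • v + c • b) := hT.le_iterate
          (convex_Icc 0 1 hv hb hc' hc.1 (sub_add_cancel 1 c)) hu h hTu.ge n
      _ ≤ (1 - c) • T^[n] v + c • T^[n] b :=
        (hT.iterate n).map_segment_le hv hb hvb hc' hc.1 (sub_add_cancel 1 c)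
      _ ≤ (1 - c) • v + c • T^[n] b := by
        gcongr
        exact hT.iterate_le hv hv le_rfl hTv n
  intro x
  have hx := hself x
  simp only [Pi.add_apply, Pi.smul_apply, smul_eq_mul] at hx
  nlinarith [hc.2]

end IsGeneratingOperator

end GeneratingOperator

/-- The offspring distributions of a multitype Galton–Watson process with type set `X`. -/
abbrev OffspringKernel (X : Type*) : Type _ := X → PMF (X →₀ ℕ)

namespace OffspringKernel

variable {X : Type*} (P : OffspringKernel X) {A : Set X} {s : X → ℝ} {x : X}

/-- The progeny generating function. -/
def gf (s : X → ℝ) (j : X) : ℝ := pgf (P j) s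

lemma isGeneratingOperator_gf : IsGeneratingOperator P.gf where
  mapsTo _ hs := ⟨fun j => (pgf_mem_Icc (P j) hs).1, fun j => (pgf_mem_Icc (P j) hs).2⟩
  monotoneOn _ hf _ hg h j := pgf_mono (P j) hf hg h
  continuousOn := continuousOn_pi.2 fun j => continuousOn_pgf (P j)
  map_segment_le _ hf _ hg h _ _ ha hb hab j := pgf_segment_le (P j) hf hg h ha hb hab
  map_one := funext fun j => pgf_one (P j)

lemma isGeneratingOperator_stopOn_gf (A : Set X) : IsGeneratingOperator (stopOn A P.gf) :=
  P.isGeneratingOperator_gf.stopOn A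

lemma indicator_const_mem_Icc (A : Set X) {u : ℝ} (hu : u ∈ Icc (0 : ℝ) 1) :
    (A.indicator fun _ => u) ∈ Icc (0 : X → ℝ) 1 :=
  ⟨indicator_nonneg fun _ _ => hu.1, indicator_le' (fun _ _ => hu.2) fun _ _ => zero_le_one⟩

section Extinction

/-- The probability, as a function of the type of the first individual, that no type in `A` ever
appears: the limit of the probabilities that none appears up to generation `n`. -/
def avoidance (A : Set X) : X → ℝ := ⨅ n, (stopOn A P.gf)^[n] (Aᶜ.indicator 1)

/-- The probability, as a function of the type of the first individual, that the types in `A`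
eventually disappear for good: the limit of the probabilities that none appears from generation `n`
on. -/
def extinction (A : Set X) : X → ℝ := ⨆ n, P.gf^[n] (P.avoidance A)

lemma compl_indicator_one_mem_Icc (A : Set X) : Aᶜ.indicator 1 ∈ Icc (0 : X → ℝ) 1 :=
  indicator_const_mem_Icc Aᶜ (right_mem_Icc.2 zero_le_one)

lemma tendsto_avoidance (A : Set X) :
    Tendsto (fun n => (stopOn A P.gf)^[n] (Aᶜ.indicator 1)) atTop (𝓝 (P.avoidance A)) := by
  have hmem := compl_indicator_one_mem_Icc A
  refine (P.isGeneratingOperator_stopOn_gf A).tendsto_iterate_iInf hmem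
    (stopOn_le_self fun x hx => ?_)
  rw [indicator_of_mem (show x ∈ Aᶜ from hx)]
  exact (P.isGeneratingOperator_gf.mapsTo hmem).2 x

lemma avoidance_mem_Icc (A : Set X) : P.avoidance A ∈ Icc 0 1 :=
  (P.isGeneratingOperator_stopOn_gf A).mem_Icc_of_tendsto_iterate
    (compl_indicator_one_mem_Icc A) (P.tendsto_avoidance A)

lemma stopOn_gf_avoidance (A : Set X) : stopOn A P.gf (P.avoidance A) = P.avoidance A :=
  (P.isGeneratingOperator_stopOn_gf A).map_eq_of_tendsto_iterate
    (compl_indicator_one_mem_Icc A) (P.tendsto_avoidance A)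

lemma avoidance_of_mem (hx : x ∈ A) : P.avoidance A x = 0 := by
  refine tendsto_nhds_unique (tendsto_pi_nhds.1 (P.tendsto_avoidance A) x) ?_
  simp only [iterate_stopOn_of_mem _ _ hx, indicator_of_notMem (notMem_compl_iff.2 hx)]
  exact tendsto_const_nhds

lemma avoidance_le_gf (A : Set X) : P.avoidance A ≤ P.gf (P.avoidance A) := by
  intro x
  by_cases hx : x ∈ A
  · rw [P.avoidance_of_mem hx]
    exact (P.isGeneratingOperator_gf.mapsTo (P.avoidance_mem_Icc A)).1 x
  · rw [← stopOn_of_notMem P.gf _ hx, P.stopOn_gf_avoidance]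

lemma tendsto_extinction (A : Set X) :
    Tendsto (fun n => P.gf^[n] (P.avoidance A)) atTop (𝓝 (P.extinction A)) :=
  P.isGeneratingOperator_gf.tendsto_iterate_iSup (P.avoidance_mem_Icc A) (P.avoidance_le_gf A)

lemma extinction_mem_Icc (A : Set X) : P.extinction A ∈ Icc 0 1 :=
  P.isGeneratingOperator_gf.mem_Icc_of_tendsto_iterate (P.avoidance_mem_Icc A)
    (P.tendsto_extinction A)

lemma gf_extinction (A : Set X) : P.gf (P.extinction A) = P.extinction A :=
  P.isGeneratingOperator_gf.map_eq_of_tendsto_iterate (P.avoidance_mem_Icc A)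
    (P.tendsto_extinction A)

lemma extinction_le (hs : s ∈ Icc 0 1) (hA : P.avoidance A ≤ s) (h : P.gf s ≤ s) :
    P.extinction A ≤ s :=
  le_of_tendsto' (P.tendsto_extinction A) fun n =>
    P.isGeneratingOperator_gf.iterate_le (P.avoidance_mem_Icc A) hs hA h n

lemma avoidance_le_extinction (A : Set X) : P.avoidance A ≤ P.extinction A :=
  ge_of_tendsto' (P.tendsto_extinction A) fun n =>
    P.isGeneratingOperator_gf.le_iterate (P.avoidance_mem_Icc A) (P.avoidance_mem_Icc A) le_rfl
      (P.avoidance_le_gf A) n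

lemma extinction_univ_le (hs : s ∈ Icc 0 1) (h : P.gf s ≤ s) : P.extinction univ ≤ s :=
  P.extinction_le hs (fun x => (P.avoidance_of_mem (mem_univ x)).trans_le (hs.1 x)) h

end Extinction

section IntermediateValues

/-- The generating function at `u`, as a function of the type of the first individual, of the number
of individuals that are the first ones on their line of descent with a type outside `A`. -/
def exitGF (A : Set X) (u : ℝ) : X → ℝ := ⨆ n, (stopOn Aᶜ P.gf)^[n] (Aᶜ.indicator fun _ => u)

variable {u : ℝ}

lemma tendsto_exitGF (A : Set X) (hu : u ∈ Icc (0 : ℝ) 1) :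
    Tendsto (fun n => (stopOn Aᶜ P.gf)^[n] (Aᶜ.indicator fun _ => u)) atTop (𝓝 (P.exitGF A u)) := by
  have hmem := indicator_const_mem_Icc Aᶜ hu
  refine (P.isGeneratingOperator_stopOn_gf Aᶜ).tendsto_iterate_iSup hmem
    (le_stopOn_self fun x hx => ?_)
  rw [indicator_of_notMem hx]
  exact (P.isGeneratingOperator_gf.mapsTo hmem).1 x

lemma exitGF_mem_Icc (A : Set X) (hu : u ∈ Icc (0 : ℝ) 1) : P.exitGF A u ∈ Icc 0 1 :=
  (P.isGeneratingOperator_stopOn_gf Aᶜ).mem_Icc_of_tendsto_iterate (indicator_const_mem_Icc Aᶜ hu)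
    (P.tendsto_exitGF A hu)

lemma gf_exitGF_of_mem (hx : x ∈ A) (hu : u ∈ Icc (0 : ℝ) 1) :
    P.gf (P.exitGF A u) x = P.exitGF A u x := by
  rw [← stopOn_of_notMem P.gf _ (notMem_compl_iff.2 hx),
    (P.isGeneratingOperator_stopOn_gf Aᶜ).map_eq_of_tendsto_iterate (indicator_const_mem_Icc Aᶜ hu)
      (P.tendsto_exitGF A hu)]

lemma exitGF_of_notMem (hx : x ∉ A) (hu : u ∈ Icc (0 : ℝ) 1) : P.exitGF A u x = u := by
  refine tendsto_nhds_unique (tendsto_pi_nhds.1 (P.tendsto_exitGF A hu) x) ?_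
  simp only [iterate_stopOn_of_mem (A := Aᶜ) _ _ hx, indicator_of_mem (show x ∈ Aᶜ from hx)]
  exact tendsto_const_nhds

lemma convexOn_exitGF (A : Set X) (y : X) : ConvexOn ℝ (Icc 0 1) fun u => P.exitGF A u y := by
  refine LinearOrder.convexOn_of_lt (convex_Icc 0 1) fun u hu v hv huv a b ha hb hab => ?_
  have hw := convex_Icc (0 : ℝ) 1 hu hv ha.le hb.le hab
  refine le_of_tendsto_of_tendsto' (tendsto_pi_nhds.1 (P.tendsto_exitGF A hw) y)
    (((tendsto_pi_nhds.1 (P.tendsto_exitGF A hu) y).const_smul a).add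
      ((tendsto_pi_nhds.1 (P.tendsto_exitGF A hv) y).const_smul b)) fun n => ?_
  have hsplit : (Aᶜ.indicator fun _ => a • u + b • v) =
      a • Aᶜ.indicator (fun _ => u) + b • Aᶜ.indicator fun _ => v := by
    ext x
    by_cases hx : x ∈ A <;> simp [hx]
  rw [hsplit]
  exact ((P.isGeneratingOperator_stopOn_gf Aᶜ).iterate n).map_segment_le
    (indicator_const_mem_Icc Aᶜ hu) (indicator_const_mem_Icc Aᶜ hv)
    (indicator_mono fun _ => huv.le) ha.le hb.le hab y

lemma lowerSemicontinuousOn_exitGF (A : Set X) (y : X) :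
    LowerSemicontinuousOn (fun u => P.exitGF A u y) (Icc 0 1) := by
  have hT := P.isGeneratingOperator_stopOn_gf Aᶜ
  simp only [exitGF, iSup_apply]
  refine lowerSemicontinuousOn_ciSup (fun u hu => ⟨1, forall_mem_range.2 fun n =>
    ((hT.iterate n).mapsTo (indicator_const_mem_Icc Aᶜ hu)).2 y⟩) fun n => ?_
  have hcont : Continuous fun u : ℝ => Aᶜ.indicator fun _ : X => u := continuous_pi fun x => by
    by_cases hx : x ∈ Aᶜ
    · simpa only [indicator_of_mem hx] using continuous_id'
    · simpa only [indicator_of_notMem hx] using continuous_const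
  exact ((continuousOn_pi.1 (hT.iterate n).continuousOn y).comp hcont.continuousOn
    fun u hu => indicator_const_mem_Icc Aᶜ hu).lowerSemicontinuousOn

lemma exitGF_zero_le_extinction_univ (A : Set X) : P.exitGF A 0 ≤ P.extinction univ := by
  have h0 : (0 : ℝ) ∈ Icc (0 : ℝ) 1 := left_mem_Icc.2 zero_le_one
  refine le_of_tendsto' (P.tendsto_exitGF A h0) fun n =>
    (P.isGeneratingOperator_stopOn_gf Aᶜ).iterate_le (indicator_const_mem_Icc Aᶜ h0)
      (P.extinction_mem_Icc univ) ?_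
      (stopOn_le_self fun x _ => (congrFun (P.gf_extinction univ) x).le) n
  rw [indicator_zero]
  exact (P.extinction_mem_Icc univ).1

lemma extinction_le_exitGF_one (A : Set X) : P.extinction A ≤ P.exitGF A 1 := by
  have h1 : (1 : ℝ) ∈ Icc (0 : ℝ) 1 := right_mem_Icc.2 zero_le_one
  have hmem := P.exitGF_mem_Icc A h1
  refine P.extinction_le hmem (fun x => ?_) fun x => ?_
  · by_cases hx : x ∈ A
    · exact (P.avoidance_of_mem hx).trans_le (hmem.1 x)
    · exact ((P.avoidance_mem_Icc A).2 x).trans_eq (P.exitGF_of_notMem hx h1).symm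
  · by_cases hx : x ∈ A
    · exact (P.gf_exitGF_of_mem hx h1).le
    · exact ((P.isGeneratingOperator_gf.mapsTo hmem).2 x).trans_eq (P.exitGF_of_notMem hx h1).symm

lemma exists_gf_eq_on_apply_eq (A : Set X) (y : X) {v : ℝ} (h0 : P.extinction univ y ≤ v)
    (h1 : v ≤ P.extinction A y) : ∃ s ∈ Icc 0 1, s y = v ∧ ∀ x ∈ A, P.gf s x = s x := by
  obtain ⟨u, hu, hv⟩ := exists_eq_of_convexOn_of_lowerSemicontinuousOn zero_le_one
    (P.convexOn_exitGF A y) (P.lowerSemicontinuousOn_exitGF A y)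
    ((P.exitGF_zero_le_extinction_univ A y).trans h0) (h1.trans (P.extinction_le_exitGF_one A y))
  exact ⟨P.exitGF A u, P.exitGF_mem_Icc A hu, hv, fun x hx => P.gf_exitGF_of_mem hx hu⟩

lemma exists_gf_eq_self_apply_eq {ι : Type*} {l : Filter ι} [l.NeBot] {A : ι → Set X}
    (hA : ∀ x, ∀ᶠ k in l, x ∈ A k) (y : X) {v : ℝ} (h0 : P.extinction univ y ≤ v)
    (h1 : ∀ k, v ≤ P.extinction (A k) y) : ∃ s ∈ Icc 0 1, P.gf s = s ∧ s y = v := by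
  choose s hs hsy hfix using fun k => P.exists_gf_eq_on_apply_eq (A k) y h0 (h1 k)
  obtain ⟨t, ht, hlim⟩ := isCompact_Icc.ultrafilter_le_nhds' ((Ultrafilter.of l).map s)
    (mem_map.2 (Eventually.of_forall hs))
  replace hlim : Tendsto s (Ultrafilter.of l) (𝓝 t) := hlim
  have hgf : Tendsto (fun k => P.gf (s k)) (Ultrafilter.of l) (𝓝 (P.gf t)) :=
    (P.isGeneratingOperator_gf.continuousOn t ht).tendsto.comp
      (tendsto_nhdsWithin_iff.2 ⟨hlim, Eventually.of_forall hs⟩)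
  refine ⟨t, ht, funext fun x => ?_, ?_⟩
  · refine tendsto_nhds_unique (tendsto_pi_nhds.1 hgf x)
      ((tendsto_pi_nhds.1 hlim x).congr' (Ultrafilter.of_le l ?_))
    filter_upwards [hA x] with k hk using (hfix k x hk).symm
  · refine tendsto_nhds_unique (tendsto_pi_nhds.1 hlim y) ?_
    simp only [hsy]
    exact tendsto_const_nhds

end IntermediateValues

section MaximumPrinciple

variable {P} {t c : ℝ}

lemma le_iterate_stopOn_gf {f : X → ℝ} (hs : s ∈ Icc 0 1) (hsub : ∀ x ∉ A, s x ≤ P.gf s x)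
    (hf : f ∈ Icc 0 1) (hsf : s ≤ f) (n : ℕ) : s ≤ (stopOn A P.gf)^[n] f :=
  (P.isGeneratingOperator_stopOn_gf A).le_iterate hf hs hsf (le_stopOn_self hsub) n

lemma iterate_stopOn_gf_segment_one_le {f : X → ℝ} (hf : f ∈ Icc 0 1) (ht : t ∈ Icc (0 : ℝ) 1)
    (n : ℕ) : (stopOn A P.gf)^[n] ((1 - t) • f + t • 1) ≤
      (1 - t) • (stopOn A P.gf)^[n] f + t • 1 := by
  have hT := (P.isGeneratingOperator_stopOn_gf A).iterate n
  simpa only [hT.map_one] using hT.map_segment_le hf (right_mem_Icc.2 zero_le_one) hf.2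
    (sub_nonneg.2 ht.2) ht.1 (sub_add_cancel 1 t)

lemma segment_one_mem_Icc {f : X → ℝ} (hf : f ∈ Icc 0 1) (ht : t ∈ Icc (0 : ℝ) 1) :
    (1 - t) • f + t • 1 ∈ Icc (0 : X → ℝ) 1 :=
  convex_Icc 0 1 hf (right_mem_Icc.2 zero_le_one) (sub_nonneg.2 ht.2) ht.1 (sub_add_cancel 1 t)

lemma le_segment_avoidance (hs : s ∈ Icc 0 1) (hsub : ∀ x ∉ A, s x ≤ P.gf s x)
    (hc : c ∈ Icc (0 : ℝ) 1) (hA : ∀ x ∈ A, s x ≤ c) :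
    s ≤ (1 - c) • P.avoidance A + c • 1 := by
  have hmem := compl_indicator_one_mem_Icc A
  have hstart : s ≤ (1 - c) • Aᶜ.indicator 1 + c • 1 := fun x => by
    by_cases hx : x ∈ A
    · simpa [hx] using hA x hx
    · simpa [hx] using hs.2 x
  exact ge_of_tendsto' (((P.tendsto_avoidance A).const_smul (1 - c)).add_const (c • 1)) fun n =>
    (le_iterate_stopOn_gf hs hsub (segment_one_mem_Icc hmem hc) hstart n).trans
      (iterate_stopOn_gf_segment_one_le hmem hc n)

open Classical in
lemma piecewise_extinction_one_mem_Icc : A.piecewise (P.extinction A) 1 ∈ Icc (0 : X → ℝ) 1 :=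
  ⟨le_piecewise (fun x _ => (P.extinction_mem_Icc A).1 x) fun _ _ => zero_le_one,
    piecewise_le (fun x _ => (P.extinction_mem_Icc A).2 x) fun _ _ => le_rfl⟩

open Classical in
lemma le_segment_piecewise_extinction (hs : s ∈ Icc 0 1) (hsub : ∀ x ∉ A, s x ≤ P.gf s x)
    (hc : c ∈ Icc (0 : ℝ) 1) (hcA : ∀ x ∈ A, P.extinction A x ≤ c)
    (hA : ∀ x ∈ A, s x ≤ P.extinction A x) :
    s ≤ (1 - c) • P.extinction A + c • A.piecewise (P.extinction A) 1 := fun x => by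
  by_cases hx : x ∈ A
  · simp only [Pi.add_apply, Pi.smul_apply, smul_eq_mul, piecewise_eq_of_mem _ _ _ hx]
    linarith [hA x hx]
  · have hle := le_segment_avoidance hs hsub hc (fun y hy => (hA y hy).trans (hcA y hy)) x
    simp only [Pi.add_apply, Pi.smul_apply, smul_eq_mul, piecewise_eq_of_notMem _ _ _ hx,
      Pi.one_apply] at hle ⊢
    linarith [mul_le_mul_of_nonneg_left (P.avoidance_le_extinction A x) (sub_nonneg.2 hc.2)]

open Classical in
lemma tendsto_iterate_stopOn_gf_piecewise_extinction (hc : c ∈ Ico (0 : ℝ) 1)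
    (hcA : ∀ x ∈ A, P.extinction A x ≤ c) :
    Tendsto (fun n => (stopOn A P.gf)^[n] (A.piecewise (P.extinction A) 1)) atTop
      (𝓝 (P.extinction A)) := by
  have hT := P.isGeneratingOperator_stopOn_gf A
  have hv := P.extinction_mem_Icc A
  have hgfv := P.gf_extinction A
  have hb : A.piecewise (P.extinction A) 1 ∈ Icc 0 1 := piecewise_extinction_one_mem_Icc
  have hseg {s} := @le_segment_piecewise_extinction X P A s c
  set v := P.extinction A
  set b := A.piecewise v 1
  have hvb : v ≤ b := le_piecewise (fun _ _ => le_rfl) fun x _ => hv.2 x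
  have hlim := hT.tendsto_iterate_iInf hb (stopOn_le_self fun x hx =>
    ((P.isGeneratingOperator_gf.mapsTo hb).2 x).trans_eq (piecewise_eq_of_notMem _ _ _ hx).symm)
  set u := ⨅ n, (stopOn A P.gf)^[n] b
  have hu : u ∈ Icc 0 1 := hT.mem_Icc_of_tendsto_iterate hb hlim
  have huA : ∀ x ∈ A, u x = v x := fun x hx => by
    refine tendsto_nhds_unique (tendsto_pi_nhds.1 hlim x) ?_
    simp only [iterate_stopOn_of_mem _ _ hx, b, piecewise_eq_of_mem _ _ _ hx]
    exact tendsto_const_nhds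
  have husub : ∀ x ∉ A, u x ≤ P.gf u x := fun x hx => by
    rw [← stopOn_of_notMem P.gf u hx, hT.map_eq_of_tendsto_iterate hb hlim]
  have hvu : v ≤ u := ge_of_tendsto' hlim fun n =>
    le_iterate_stopOn_gf hv (fun x _ => (congrFun hgfv x).ge) hb hvb n
  have huv : u ≤ v := hT.le_of_tendsto_iterate_of_le_segment hv hb hvb
    (stopOn_le_self fun x _ => (congrFun hgfv x).le) hlim hc
    (hseg hu husub (Ico_subset_Icc_self hc) hcA fun x hx => (huA x hx).le)
  rwa [huv.antisymm hvu] at hlim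

lemma le_segment_extinction (hc : c ∈ Ico (0 : ℝ) 1) (hcA : ∀ x ∈ A, P.extinction A x ≤ c)
    (hs : s ∈ Icc 0 1) (hsub : ∀ x ∉ A, s x ≤ P.gf s x) (ht : t ∈ Icc (0 : ℝ) 1)
    (hA : ∀ x ∈ A, s x ≤ (1 - t) * P.extinction A x + t) :
    s ≤ (1 - t) • P.extinction A + t • 1 := by
  classical
  have hstart : s ≤ (1 - t) • A.piecewise (P.extinction A) 1 + t • 1 := fun x => by
    by_cases hx : x ∈ A
    · simpa [hx] using hA x hx
    · simpa [hx] using hs.2 x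
  exact ge_of_tendsto' (((tendsto_iterate_stopOn_gf_piecewise_extinction hc hcA).const_smul
    (1 - t)).add_const (t • 1)) fun n =>
      (le_iterate_stopOn_gf hs hsub (segment_one_mem_Icc piecewise_extinction_one_mem_Icc ht)
        hstart n).trans (iterate_stopOn_gf_segment_one_le piecewise_extinction_one_mem_Icc ht n)

end MaximumPrinciple

section Irreducible

/-- Any type can have any other type among its descendants. -/
def IsIrreducible : Prop :=
  ∀ i j, Relation.ReflTransGen (fun a b => ∃ r ∈ (P a).support, r b ≠ 0) i j

/-- Each individual has exactly one child with probability one. -/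
def IsSingular : Prop := ∀ j, ∀ r ∈ (P j).support, r.degree = 1

namespace IsIrreducible

variable {P} {w : X → ℝ}

lemma forall_of_exists (hP : P.IsIrreducible) {p : X → Prop}
    (h : ∀ j, p j → ∀ r ∈ (P j).support, ∀ x, r x ≠ 0 → p x) {j : X} (hj : p j) (x : X) : p x := by
  induction hP j x with
  | refl => exact hj
  | tail _ hxy ih =>
    obtain ⟨r, hr, hx⟩ := hxy
    exact h _ ih r hr _ hx

lemma eq_of_apply_eq (hP : P.IsIrreducible) (hs : s ∈ Icc 0 1) (hw : w ∈ Icc 0 1) (hsw : s ≤ w)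
    (hsub : s ≤ P.gf s) (hsuper : P.gf w ≤ w) (hpos : ∀ x, 0 < w x) {j : X} (hj : s j = w j) :
    s = w :=
  funext <| hP.forall_of_exists (p := fun j => s j = w j) (fun j hj _ hr _ hx =>
    eq_of_pgf_le (P j) hs hw hsw hpos ((hsuper j).trans (hj.ge.trans (hsub j))) hr hx) hj

lemma lt_one (hP : P.IsIrreducible) (hs : s ∈ Icc 0 1) (hfix : P.gf s = s) (hne : s ≠ 1) (j : X) :
    s j < 1 :=
  (hs.2 j).lt_of_ne fun hj => hne <| hP.eq_of_apply_eq hs (right_mem_Icc.2 zero_le_one) hs.2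
    hfix.ge P.isGeneratingOperator_gf.map_one.le (fun _ => one_pos) hj

lemma isSingular_of_degree_le_one (hP : P.IsIrreducible) (hfin : A.Finite) (hne : A.Nonempty)
    (hv1 : ∀ x, P.extinction A x < 1) (hdegree : ∀ j, ∀ r ∈ (P j).support, r.degree ≤ 1) :
    P.IsSingular := by
  have hv := P.extinction_mem_Icc A
  have hgfv := P.gf_extinction A
  obtain ⟨jmax, -, hmax⟩ := exists_max_image A (P.extinction A) hfin hne
  obtain ⟨jmin, -, hmin⟩ := exists_min_image A (P.extinction A) hfin hne
  set v := P.extinction A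
  set c := v jmin
  have hc : c ∈ Icc (0 : ℝ) 1 := ⟨hv.1 jmin, hv.2 jmin⟩
  have hcv : (fun _ => c) ≤ v := by
    simpa using le_segment_extinction ⟨hv.1 jmax, hv1 jmax⟩ hmax
      (s := fun _ => c) ⟨fun _ => hc.1, fun _ => hc.2⟩
      (fun x _ => le_pgf_const (P x) (hdegree x) hc) (left_mem_Icc.2 zero_le_one)
      fun x hx => by simpa using hmin x hx
  have hle : ∀ j, ∀ r ∈ (P j).support, c ≤ evalMonomial v r := fun j r hr => calc
    c = c ^ 1 := (pow_one c).symm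
    _ ≤ c ^ r.degree := pow_le_pow_of_le_one hc.1 hc.2 (hdegree j r hr)
    _ = evalMonomial (fun _ => c) r := (evalMonomial_const c r).symm
    _ ≤ evalMonomial v r := evalMonomial_mono (fun _ => hc.1) hcv r
  have hstep : ∀ j, v j = c → ∀ r ∈ (P j).support, r.degree = 1 ∧ ∀ x, r x ≠ 0 → v x = c := by
    intro j hj r hr
    have heq : c = evalMonomial v r := by
      refine eq_on_support_of_tsum_le (P j) (fun _ => hc) (evalMonomial_mem_Icc hv) (hle j) ?_ r hr
      rw [((hasSum_toReal_pmf (P j)).mul_right c).tsum_eq, one_mul, ← hj]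
      exact (congrFun hgfv j).le
    have hdeg : r.degree = 1 := (hdegree j r hr).antisymm <| Nat.one_le_iff_ne_zero.2 fun h0 =>
      (hv1 jmin).ne (by simpa [(Finsupp.degree_eq_zero_iff r).1 h0] using heq)
    refine ⟨hdeg, fun x hx => ?_⟩
    obtain ⟨r', rfl⟩ := exists_eq_single_add hx
    have hr' : r' = 0 := (Finsupp.degree_eq_zero_iff r').1 (by simpa using hdeg)
    simpa [hr'] using heq.symm
  have hall := hP.forall_of_exists (p := fun j => v j = c) (fun j hj r hr => (hstep j hj r hr).2)
    (rfl : v jmin = c)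
  exact fun j r hr => (hstep j (hall j) r hr).1

lemma eq_segment_one_of_apply_eq (hP : P.IsIrreducible) (hs : s ∈ Icc 0 1) (hsub : s ≤ P.gf s)
    (hw : w ∈ Icc 0 1) (hsuper : P.gf w ≤ w) {t : ℝ} (ht : t ∈ Ioc (0 : ℝ) 1)
    (hle : s ≤ (1 - t) • w + t • 1) {j : X} (hj : s j = (1 - t) * w j + t) :
    s = (1 - t) • w + t • 1 := by
  have ht' : 0 ≤ 1 - t := sub_nonneg.2 ht.2
  refine hP.eq_of_apply_eq hs (segment_one_mem_Icc hw (Ioc_subset_Icc_self ht)) hle hsub ?_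
    (fun x => ?_) (j := j) (by simpa using hj)
  · refine (P.isGeneratingOperator_gf.map_segment_le hw (right_mem_Icc.2 zero_le_one) hw.2 ht'
      ht.1.le (sub_add_cancel 1 t)).trans ?_
    rw [P.isGeneratingOperator_gf.map_one]
    gcongr
  · simpa using add_pos_of_nonneg_of_pos (mul_nonneg ht' (hw.1 x)) ht.1

lemma le_extinction (hP : P.IsIrreducible) (hns : ¬ P.IsSingular) (hfin : A.Finite)
    (hne : A.Nonempty) (hs : s ∈ Icc 0 1) (hsub : s ≤ P.gf s) (hs1 : ∀ x, s x < 1) :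
    s ≤ P.extinction A := by
  have hv := P.extinction_mem_Icc A
  have hgfv := P.gf_extinction A
  by_cases hv_one : P.extinction A = 1
  · exact hv_one ▸ hs.2
  have hv1 := hP.lt_one hv hgfv hv_one
  obtain ⟨jmax, -, hmax⟩ := exists_max_image A (P.extinction A) hfin hne
  have hcompare {t : ℝ} (ht : t ∈ Icc (0 : ℝ) 1)
      (hA : ∀ x ∈ A, s x ≤ (1 - t) * P.extinction A x + t) :=
    le_segment_extinction ⟨hv.1 jmax, hv1 jmax⟩ hmax hs (fun x _ => hsub x) ht hA
  -- The least `t` with `s ≤ (1 - t) v + t` on `A`.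
  obtain ⟨j, -, hj⟩ := exists_max_image A
    (fun x => (s x - P.extinction A x) / (1 - P.extinction A x)) hfin hne
  set v := P.extinction A
  have hpos : ∀ x, 0 < 1 - v x := fun x => sub_pos.2 (hv1 x)
  set t := (s j - v j) / (1 - v j)
  have hA : ∀ x ∈ A, s x ≤ (1 - t) * v x + t := fun x hx => by
    linarith [(div_le_iff₀ (hpos x)).1 (hj x hx)]
  rcases le_or_gt t 0 with ht0 | ht0
  · simpa using hcompare (left_mem_Icc.2 zero_le_one) fun x hx => by nlinarith [hA x hx, hpos x]
  have ht1 : t < 1 := (div_lt_one (hpos j)).2 (by linarith [hs1 j])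
  -- For `t > 0` equality at one type propagates, and strict convexity then excludes two children.
  have hsw : s = (1 - t) • v + t • 1 :=
    hP.eq_segment_one_of_apply_eq hs hsub hv hgfv.le ⟨ht0, ht1.le⟩ (hcompare ⟨ht0.le, ht1.le⟩ hA)
      (j := j) (by linarith [div_mul_cancel₀ (s j - v j) (hpos j).ne'])
  refine absurd (hP.isSingular_of_degree_le_one hfin hne hv1 fun i =>
    degree_le_one_of_segment_one_le_pgf (P i) hv hv1 (sub_pos.2 ht1) ht0 (sub_add_cancel 1 t) ?_)
    hns
  have hi := (hsw ▸ hsub) i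
  simpa [gf, ← congrFun hgfv i] using hi

end IsIrreducible

end Irreducible

section Lumping

variable {Y : Type*}

/-- The process `Q` arises from `P` by identifying types along `π`: the types of the children of an
individual of type `x`, seen in `Y`, are distributed as the offspring of type `π x`. -/
def IsLumping (P : OffspringKernel X) (Q : OffspringKernel Y) (π : X → Y) : Prop :=
  ∀ x, Q (π x) = (P x).map (Finsupp.mapDomain π)

lemma iterate_comp_of_comp {T : (X → ℝ) → X → ℝ} {S : (Y → ℝ) → Y → ℝ} {π : X → Y} {f : Y → ℝ}
    (hS : IsGeneratingOperator S) (h : ∀ g ∈ Icc 0 1, T (g ∘ π) = S g ∘ π) (hf : f ∈ Icc 0 1)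
    (n : ℕ) : T^[n] (f ∘ π) = S^[n] f ∘ π := by
  induction n with
  | zero => rfl
  | succ n ih =>
    rw [Function.iterate_succ_apply', ih, h _ ((hS.iterate n).mapsTo hf),
      Function.iterate_succ_apply']

namespace IsLumping

variable {P} {Q : OffspringKernel Y} {π : X → Y} (h : P.IsLumping Q π)
include h

lemma gf_comp {f : Y → ℝ} (hf : f ∈ Icc 0 1) : P.gf (f ∘ π) = Q.gf f ∘ π := funext fun x => by
  rw [gf, Function.comp_apply, gf, h x, pgf_map_mapDomain _ π hf]

lemma stopOn_gf_comp (B : Set Y) {f : Y → ℝ} (hf : f ∈ Icc 0 1) :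
    stopOn (π ⁻¹' B) P.gf (f ∘ π) = stopOn B Q.gf f ∘ π := funext fun x => by
  by_cases hx : π x ∈ B
  · rw [stopOn_of_mem _ _ (mem_preimage.2 hx), Function.comp_apply, Function.comp_apply,
      stopOn_of_mem _ _ hx]
  · rw [stopOn_of_notMem _ _ (show x ∉ π ⁻¹' B from hx), Function.comp_apply,
      stopOn_of_notMem _ _ hx, h.gf_comp hf, Function.comp_apply]

lemma avoidance_preimage (B : Set Y) : P.avoidance (π ⁻¹' B) = Q.avoidance B ∘ π := by
  refine tendsto_nhds_unique (P.tendsto_avoidance _) ?_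
  have hstart : (π ⁻¹' B)ᶜ.indicator (1 : X → ℝ) = Bᶜ.indicator 1 ∘ π := rfl
  simp only [hstart, iterate_comp_of_comp (Q.isGeneratingOperator_stopOn_gf B)
    (fun _ hg => h.stopOn_gf_comp B hg) (compl_indicator_one_mem_Icc B)]
  exact tendsto_pi_nhds.2 fun x => tendsto_pi_nhds.1 (Q.tendsto_avoidance B) (π x)

lemma extinction_preimage (B : Set Y) : P.extinction (π ⁻¹' B) = Q.extinction B ∘ π := by
  refine tendsto_nhds_unique (P.tendsto_extinction _) ?_
  simp only [h.avoidance_preimage, iterate_comp_of_comp Q.isGeneratingOperator_gf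
    (fun _ hg => h.gf_comp hg) (Q.avoidance_mem_Icc B)]
  exact tendsto_pi_nhds.2 fun x => tendsto_pi_nhds.1 (Q.tendsto_extinction B) (π x)

lemma isSingular (hπ : Function.Surjective π) (hP : P.IsSingular) : Q.IsSingular :=
  hπ.forall.2 fun x u hu => by
    rw [h x, PMF.mem_support_map_iff] at hu
    obtain ⟨r, hr, rfl⟩ := hu
    rw [Finsupp.degree_mapDomain, hP x r hr]

end IsLumping

end Lumping

end OffspringKernel

/-- The space of family trees of a single individual: an outcome assigns an offspring vector to each
line of descent from it, the most recent entry first. -/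
abbrev FamilyTree (d : ℕ) : Type := List (ℕ × TypeSet d) → OffspringVec d

namespace FamilyTree

variable {d : ℕ}

/-- The individual with the given line of descent appears in the family tree. -/
def AppearsIn (η : FamilyTree d) : List (ℕ × TypeSet d) → Prop
  | [] => True
  | (i, j) :: l => AppearsIn η l ∧ i < η l j

/-- The family tree of the child `a` of the root. -/
def subtree (a : ℕ × TypeSet d) (η : FamilyTree d) : FamilyTree d := fun l => η (l ++ [a])

/-- The event that every child of the root, of type `x` say, has its family tree in `E x`. -/
def childrenIn (E : TypeSet d → Set (FamilyTree d)) : Set (FamilyTree d) :=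
  {η | ∀ a : ℕ × TypeSet d, a.1 < η [] a.2 → subtree a η ∈ E a.2}

/-- The event that no individual of a type in `A` appears in the generations `N, …, N + m` of the
family tree of an individual of type `y`. -/
def avoids (A : Set (TypeSet d)) (N m : ℕ) (y : TypeSet d) : Set (FamilyTree d) :=
  {η | ∀ l : List (ℕ × TypeSet d), N ≤ l.length → l.length ≤ N + m → AppearsIn η l →
    typeOf (y, l) ∉ A}

lemma appears_iff (ω : Outcome d) (root : TypeSet d) (l : List (ℕ × TypeSet d)) :
    Appears ω root l ↔ AppearsIn (fun l => ω (root, l)) l := by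
  induction l with
  | nil => rfl
  | cons a l ih => exact and_congr ih Iff.rfl

lemma appearsIn_append (η : FamilyTree d) (l : List (ℕ × TypeSet d)) (a : ℕ × TypeSet d) :
    AppearsIn η (l ++ [a]) ↔ a.1 < η [] a.2 ∧ AppearsIn (subtree a η) l := by
  induction l with
  | nil => exact and_comm
  | cons b l ih => exact (and_congr_left' ih).trans and_assoc

lemma typeOf_append (y : TypeSet d) (l : List (ℕ × TypeSet d)) (a : ℕ × TypeSet d) :
    typeOf (y, l ++ [a]) = typeOf (a.2, l) := by
  cases l <;> rfl

lemma avoids_succ (A : Set (TypeSet d)) (N m : ℕ) (y : TypeSet d) :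
    avoids A (N + 1) m y = childrenIn (avoids A N m) := by
  ext η
  constructor
  · intro h a ha l hN hm hl
    rw [← typeOf_append y]
    exact h _ (by simpa using hN) (by simp; omega) ((appearsIn_append _ _ _).2 ⟨ha, hl⟩)
  · intro h l hN hm hl
    rcases List.eq_nil_or_concat' l with rfl | ⟨l, a, rfl⟩
    · simp at hN
    · simp only [List.length_append, List.length_singleton] at hN hm
      rw [appearsIn_append] at hl
      rw [typeOf_append]
      exact h a hl.1 l (by omega) (by omega) hl.2

lemma avoids_zero_zero {A : Set (TypeSet d)} {y : TypeSet d} (hy : y ∉ A) :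
    avoids A 0 0 y = univ :=
  eq_univ_of_forall fun _ l _ hl _ => by rwa [List.eq_nil_of_length_eq_zero (Nat.le_zero.1 hl)]

lemma avoids_zero_of_mem {A : Set (TypeSet d)} {y : TypeSet d} (hy : y ∈ A) (m : ℕ) :
    avoids A 0 m y = ∅ :=
  eq_empty_of_forall_notMem fun _ h => h [] le_rfl (Nat.zero_le _) trivial hy

lemma avoids_zero_succ {A : Set (TypeSet d)} {y : TypeSet d} (hy : y ∉ A) (m : ℕ) :
    avoids A 0 (m + 1) y = childrenIn (avoids A 0 m) := by
  rw [← avoids_succ A 0 m y]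
  ext η
  refine ⟨fun h l _ hm hl => h l (Nat.zero_le _) (by omega) hl, fun h l _ hm hl => ?_⟩
  cases l with
  | nil => exact hy
  | cons a l => exact h _ (by simp) (by omega) hl

lemma antitone_avoids (A : Set (TypeSet d)) (N : ℕ) (y : TypeSet d) :
    Antitone fun m => avoids A N m y :=
  fun _ _ hm _ h l hN hl => h l hN (by omega)

lemma monotone_iInter_avoids (A : Set (TypeSet d)) (y : TypeSet d) :
    Monotone fun N => ⋂ m, avoids A N m y := fun N N' hN η h => by
  simp only [mem_iInter] at h ⊢
  exact fun m l hl hl' => h (N' + m - N) l (by omega) (by omega)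

lemma extinctionEvent_eq_preimage (A : Set (TypeSet d)) (y : TypeSet d) :
    extinctionEvent y A = (fun ω l => ω (y, l)) ⁻¹' ⋃ N, ⋂ m, avoids A N m y := by
  ext ω
  simp only [extinctionEvent, population, mem_ofPred_eq, mem_preimage, mem_iUnion, mem_iInter,
    encard_eq_zero, eq_empty_iff_forall_notMem, avoids, appears_iff]
  refine exists_congr fun N => ⟨fun h m l hN _ hl hA => ?_, fun h m hm j hj l hl => ?_⟩
  · exact h l.length hN _ hA l ⟨rfl, hl, rfl⟩
  · obtain ⟨rfl, hl, rfl⟩ := hl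
    exact h (l.length - N) l hm (by omega) hl hj

section Measurability

instance instDiscreteMeasurableSpaceOffspringVec : DiscreteMeasurableSpace (OffspringVec d) :=
  ⟨fun _ => MeasurableSpace.measurableSet_top⟩

lemma measurableSet_eval (l : List (ℕ × TypeSet d)) (R : Set (OffspringVec d)) :
    MeasurableSet {η : FamilyTree d | η l ∈ R} :=
  measurable_pi_apply (X := fun _ => OffspringVec d) l MeasurableSet.of_discrete

lemma measurableSet_appearsIn (l : List (ℕ × TypeSet d)) :
    MeasurableSet {η : FamilyTree d | AppearsIn η l} := by
  induction l with
  | nil => exact MeasurableSet.univ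
  | cons a l ih => exact ih.inter (measurableSet_eval l {r | a.1 < r a.2})

lemma measurableSet_avoids (A : Set (TypeSet d)) (N m : ℕ) (y : TypeSet d) :
    MeasurableSet (avoids A N m y) := by
  simp only [avoids, ofPred_forall]
  refine MeasurableSet.iInter fun l => ?_
  refine MeasurableSet.iInter fun _ => MeasurableSet.iInter fun _ => ?_
  by_cases h : typeOf (y, l) ∈ A
  · simp only [h, not_true_eq_false]
    exact (measurableSet_appearsIn l).compl
  · simp [h]

lemma measurableSet_iUnion_iInter_avoids (A : Set (TypeSet d)) (y : TypeSet d) :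
    MeasurableSet (⋃ N, ⋂ m, avoids A N m y) :=
  MeasurableSet.iUnion fun N => MeasurableSet.iInter fun m => measurableSet_avoids A N m y

lemma measurable_subtree (a : ℕ × TypeSet d) : Measurable (subtree (d := d) a) :=
  measurable_pi_lambda _ fun _ => measurable_pi_apply _

lemma measurableSet_childrenIn {E : TypeSet d → Set (FamilyTree d)}
    (hE : ∀ y, MeasurableSet (E y)) : MeasurableSet (childrenIn E) := by
  simp only [childrenIn, ofPred_forall, imp_iff_not_or]
  exact MeasurableSet.iInter fun a =>
    (measurableSet_eval [] {r | a.1 < r a.2}).compl.union (measurable_subtree a (hE a.2))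

lemma measurable_familyTree (y : TypeSet d) :
    Measurable fun (ω : Outcome d) (l : List (ℕ × TypeSet d)) => ω (y, l) :=
  measurable_pi_lambda _ fun _ => measurable_pi_apply _

lemma measurableSet_extinctionEvent (A : Set (TypeSet d)) (y : TypeSet d) :
    MeasurableSet (extinctionEvent y A) := by
  rw [extinctionEvent_eq_preimage]
  exact measurable_familyTree y (measurableSet_iUnion_iInter_avoids A y)

end Measurability

section Law

variable (P : OffspringKernel (TypeSet d))

/-- The law of the family tree of an individual of type `y`. -/
def law (y : TypeSet d) : Measure (FamilyTree d) :=
  Measure.infinitePi fun l : List (ℕ × TypeSet d) => (P (typeOf (y, l))).toMeasure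

instance instIsProbabilityMeasureLaw (y : TypeSet d) : IsProbabilityMeasure (law P y) := by
  unfold law; infer_instance

/-- The laws of the independent pieces into which the family tree of an individual of type `y`
splits: the piece `some a` is the family tree of the virtual child `a`, and in the piece `none` only
the value at `[]` matters, which is the offspring vector of the individual itself. -/
def pieceLaw (y : TypeSet d) (o : Option (ℕ × TypeSet d)) : Measure (FamilyTree d) :=
  Measure.infinitePi fun l : List (ℕ × TypeSet d) => (P (typeOf (y, l ++ o.toList))).toMeasure

instance instIsProbabilityMeasurePieceLaw (y : TypeSet d) (o : Option (ℕ × TypeSet d)) :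
    IsProbabilityMeasure (pieceLaw P y o) := by
  unfold pieceLaw; infer_instance

/-- The family tree made of the given pieces, see `pieceLaw`. -/
def assemble (ω : Option (ℕ × TypeSet d) → FamilyTree d) : FamilyTree d :=
  fun l => ω l.getLast? l.dropLast

lemma measurable_assemble : Measurable (assemble (d := d)) := by
  unfold assemble; fun_prop

lemma assemble_nil (ω : Option (ℕ × TypeSet d) → FamilyTree d) : assemble ω [] = ω none [] := rfl

lemma subtree_assemble (a : ℕ × TypeSet d) (ω : Option (ℕ × TypeSet d) → FamilyTree d) :
    subtree a (assemble ω) = ω (some a) := by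
  ext1 l
  simp [subtree, assemble]

lemma pieceLaw_some (y : TypeSet d) (a : ℕ × TypeSet d) : pieceLaw P y (some a) = law P a.2 := by
  simp only [pieceLaw, law, Option.toList_some, typeOf_append]

lemma pieceLaw_none_apply (y : TypeSet d) (r : OffspringVec d) :
    pieceLaw P y none {η | η [] ∈ ({r} : Set _)} = P y r := by
  have hmap := congrArg (fun μ => μ {r}) (Measure.infinitePi_map_eval
    (fun l : List (ℕ × TypeSet d) => (P (typeOf (y, l ++ none.toList))).toMeasure) [])
  have heval : Measurable fun η : FamilyTree d => η [] := measurable_pi_apply _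
  simp only [PMF.toMeasure_apply_singleton _ _ (measurableSet_singleton r)] at hmap
  rwa [Measure.map_apply heval (measurableSet_singleton r)] at hmap

lemma injective_getLast?_dropLast {α : Type*} :
    Function.Injective fun l : List α => (l.getLast?, l.dropLast) := by
  intro l l' h
  rcases List.eq_nil_or_concat' l with rfl | ⟨l, a, rfl⟩ <;>
    rcases List.eq_nil_or_concat' l' with rfl | ⟨l', a', rfl⟩ <;> simp_all

lemma map_assemble (y : TypeSet d) :
    (Measure.infinitePi (pieceLaw P y)).map assemble = law P y := by
  have hpull := Measure.map_infinitePi_infinitePi_of_inj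
    (P := fun v : Option (ℕ × TypeSet d) × List (ℕ × TypeSet d) =>
      (P (typeOf (y, v.2 ++ v.1.toList))).toMeasure) injective_getLast?_dropLast
  have hcurry := Measure.infinitePi_map_curry_symm
    (fun (o : Option (ℕ × TypeSet d)) (l : List (ℕ × TypeSet d)) =>
      (P (typeOf (y, l ++ o.toList))).toMeasure)
  rw [← hcurry, Measure.map_map (by fun_prop) (by fun_prop)] at hpull
  refine hpull.trans ?_
  unfold law
  congr! 3 with l
  rcases List.eq_nil_or_concat' l with rfl | ⟨l, a, rfl⟩ <;> simp

/-- The children of an individual with offspring vector `r`. -/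
def children (r : OffspringVec d) : Finset (ℕ × TypeSet d) :=
  {a ∈ Finset.range r.degree ×ˢ r.support | a.1 < r a.2}

lemma mem_children {r : OffspringVec d} {a : ℕ × TypeSet d} : a ∈ children r ↔ a.1 < r a.2 := by
  simp only [children, Finset.mem_filter, Finset.mem_product, Finset.mem_range,
    Finsupp.mem_support_iff, and_iff_right_iff_imp]
  exact fun h => ⟨h.trans_le (Finsupp.le_degree a.2 r), (Nat.zero_le _).trans_lt h |>.ne'⟩

lemma prod_children {M : Type*} [CommMonoid M] (r : OffspringVec d) (f : TypeSet d → M) :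
    ∏ a ∈ children r, f a.2 = r.prod fun x n => f x ^ n := by
  rw [Finset.prod_finset_product_right (children r) r.support (fun x => Finset.range (r x))]
  · simp only [Finset.prod_const, Finset.card_range]
    rfl
  · intro a
    rw [mem_children, Finset.mem_range, Finsupp.mem_support_iff]
    omega

lemma law_childrenIn_inter {E : TypeSet d → Set (FamilyTree d)} (hE : ∀ y, MeasurableSet (E y))
    (y : TypeSet d) (r : OffspringVec d) :
    law P y (childrenIn E ∩ {η | η [] ∈ ({r} : Set _)}) =
      P y r * r.prod fun x n => law P x (E x) ^ n := by
  let t : Option (ℕ × TypeSet d) → Set (FamilyTree d) :=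
    fun o => o.elim {η | η [] ∈ ({r} : Set _)} fun a => E a.2
  have ht : ∀ o, MeasurableSet (t o)
    | none => measurableSet_eval [] {r}
    | some a => hE a.2
  have hset : assemble ⁻¹' (childrenIn E ∩ {η | η [] ∈ ({r} : Set _)}) =
      Set.pi (children r).insertNone t := by
    ext ω
    simp only [childrenIn, mem_preimage, mem_inter_iff, mem_ofPred_eq, subtree_assemble,
      assemble_nil, mem_singleton_iff, Set.mem_pi, Finset.mem_coe, Finset.forall_mem_insertNone,
      mem_children, t, Option.elim]
    rw [and_comm]
    exact and_congr_right fun h => by rw [h]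
  rw [← map_assemble P y, Measure.map_apply measurable_assemble
    ((measurableSet_childrenIn hE).inter (measurableSet_eval [] {r})), hset,
    Measure.infinitePi_pi _ (fun o _ => ht o), Finset.prod_insertNone, ← prod_children]
  simp only [t, Option.elim, pieceLaw_some, pieceLaw_none_apply]

/-- The branching property: given its offspring vector, the family trees of the children of an
individual are independent, each distributed as a family tree of its type. -/
lemma law_real_childrenIn {E : TypeSet d → Set (FamilyTree d)} (hE : ∀ y, MeasurableSet (E y))
    (y : TypeSet d) : (law P y).real (childrenIn E) = P.gf (fun x => (law P x).real (E x)) y := by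
  have hfiber : (law P y) (childrenIn E) =
      ∑' r : OffspringVec d, P y r * r.prod fun x n => law P x (E x) ^ n := by
    simp only [← law_childrenIn_inter P hE]
    rw [← measure_iUnion]
    · rw [← inter_iUnion, eq_univ_of_forall fun η => mem_iUnion.2 ⟨η [], rfl⟩, inter_univ]
    · exact fun r r' hr => disjoint_left.2 fun η h h' => hr (h.2.symm.trans h'.2)
    · exact fun r => (measurableSet_childrenIn hE).inter (measurableSet_eval [] {r})
  have hfinite : ∀ r : OffspringVec d, P y r * r.prod (fun x n => law P x (E x) ^ n) ≠ ∞ :=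
    fun r => ENNReal.mul_ne_top ((P y).apply_ne_top r)
      (ENNReal.prod_ne_top fun x _ => ENNReal.pow_ne_top (measure_ne_top _ _))
  rw [measureReal_def, hfiber, ENNReal.tsum_toReal_eq hfinite]
  simp only [ENNReal.toReal_mul, Finsupp.prod, ENNReal.toReal_prod, ENNReal.toReal_pow]
  rfl

lemma law_real_avoids_zero (A : Set (TypeSet d)) (m : ℕ) :
    (fun y => (law P y).real (avoids A 0 m y)) = (stopOn A P.gf)^[m] (Aᶜ.indicator 1) := by
  induction m with
  | zero =>
    ext y
    by_cases hy : y ∈ A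
    · simp [avoids_zero_of_mem hy, hy]
    · simp [avoids_zero_zero hy, hy]
  | succ m ih =>
    ext y
    rw [Function.iterate_succ_apply', ← ih]
    by_cases hy : y ∈ A
    · simp [stopOn_of_mem _ _ hy, avoids_zero_of_mem hy]
    · rw [stopOn_of_notMem _ _ hy, avoids_zero_succ hy,
        law_real_childrenIn P (measurableSet_avoids A 0 m)]

lemma law_real_avoids (A : Set (TypeSet d)) (N m : ℕ) :
    (fun y => (law P y).real (avoids A N m y)) =
      P.gf^[N] ((stopOn A P.gf)^[m] (Aᶜ.indicator 1)) := by
  induction N with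
  | zero => exact law_real_avoids_zero P A m
  | succ N ih =>
    ext y
    rw [Function.iterate_succ_apply', ← ih, avoids_succ,
      law_real_childrenIn P (measurableSet_avoids A N m)]

lemma law_real_iInter_avoids (A : Set (TypeSet d)) (N : ℕ) (y : TypeSet d) :
    (law P y).real (⋂ m, avoids A N m y) = P.gf^[N] (P.avoidance A) y := by
  have hgf : Tendsto (fun m => P.gf^[N] ((stopOn A P.gf)^[m] (Aᶜ.indicator 1))) atTop
      (𝓝 (P.gf^[N] (P.avoidance A))) :=
    ((P.isGeneratingOperator_gf.iterate N).continuousOn _ (P.avoidance_mem_Icc A)).tendsto.comp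
      (tendsto_nhdsWithin_iff.2 ⟨P.tendsto_avoidance A, Eventually.of_forall fun m =>
        ((P.isGeneratingOperator_stopOn_gf A).iterate m).mapsTo
          (OffspringKernel.compl_indicator_one_mem_Icc A)⟩)
  refine tendsto_nhds_unique ?_ (tendsto_pi_nhds.1 hgf y)
  simp only [← law_real_avoids]
  exact (ENNReal.tendsto_toReal (measure_ne_top _ _)).comp (tendsto_measure_iInter_atTop
    (fun m => (measurableSet_avoids A N m y).nullMeasurableSet) (antitone_avoids A N y)
    ⟨0, measure_ne_top _ _⟩)

lemma law_real_iUnion_iInter_avoids (A : Set (TypeSet d)) (y : TypeSet d) :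
    (law P y).real (⋃ N, ⋂ m, avoids A N m y) = P.extinction A y := by
  refine tendsto_nhds_unique ?_ (tendsto_pi_nhds.1 (P.tendsto_extinction A) y)
  simp only [← law_real_iInter_avoids]
  exact (ENNReal.tendsto_toReal (measure_ne_top _ _)).comp
    (tendsto_measure_iUnion_atTop (monotone_iInter_avoids A y))

end Law

end FamilyTree

namespace BlockLHBP

variable {d : ℕ} (p : BlockLHBP d) {s : TypeSet d → ℝ}

/-- The offspring kernel underlying a block lower Hessenberg branching process. -/
abbrev toKernel : OffspringKernel (TypeSet d) := p.law

/-- The types of level at most `k`. -/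
def lowLevels (d k : ℕ) : Set (TypeSet d) := {x | x.1 ≤ k}

lemma mem_fixedPoints : s ∈ p.fixedPoints ↔ s ∈ Icc 0 1 ∧ p.toKernel.gf s = s := by
  rw [← Set.pi_univ_Icc]
  simp only [fixedPoints, mem_ofPred_eq, mem_univ_pi, eq_comm (a := s)]
  rfl

lemma finite_lowLevels (k : ℕ) : (lowLevels d k).Finite :=
  ((finite_Iic k).prod (finite_univ (α := Fin d))).subset fun _ hx => ⟨hx, mem_univ _⟩

lemma nonempty_lowLevels [NeZero d] (k : ℕ) : (lowLevels d k).Nonempty :=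
  ⟨(0, 0), Nat.zero_le k⟩

lemma monotone_lowLevels : Monotone (lowLevels d) := fun _ _ hk _ hx => le_trans hx hk

lemma exists_mem_support_ne_zero_of_meanProgeny_pos {i j : TypeSet d}
    (h : 0 < p.meanProgeny i j) : ∃ r ∈ (p.law i).support, r j ≠ 0 := by
  by_contra! h0
  refine h.ne' (ENNReal.tsum_eq_zero.2 fun r => ?_)
  by_cases hr : r ∈ (p.law i).support
  · simp [h0 r hr]
  · simp [(PMF.apply_eq_zero_iff _ _).2 hr]

variable {p} in
lemma Irreducible.isIrreducible (hp : p.Irreducible) : p.toKernel.IsIrreducible := fun i j =>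
  Relation.ReflTransGen.mono (fun _ _ => p.exists_mem_support_ne_zero_of_meanProgeny_pos) i j
    (hp i j)

section Extinction

instance instIsProbabilityMeasureProb : IsProbabilityMeasure p.prob := by
  unfold prob; infer_instance

lemma map_prob (y : TypeSet d) :
    p.prob.map (fun ω l => ω (y, l)) = FamilyTree.law p.toKernel y :=
  Measure.map_infinitePi_infinitePi_of_inj
    (P := fun v : VirtualIndividual d => (p.law (typeOf v)).toMeasure)
    (f := fun l => (y, l)) fun _ _ h => (Prod.ext_iff.1 h).2

lemma prob_real_extinctionEvent (A : Set (TypeSet d)) (y : TypeSet d) :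
    p.prob.real (extinctionEvent y A) = p.toKernel.extinction A y := by
  rw [FamilyTree.extinctionEvent_eq_preimage, ← FamilyTree.law_real_iUnion_iInter_avoids,
    ← map_prob, map_measureReal_apply (FamilyTree.measurable_familyTree y)
      (FamilyTree.measurableSet_iUnion_iInter_avoids A y)]

lemma globalExtinction_eq_extinction_univ :
    p.globalExtinction = p.toKernel.extinction univ :=
  funext fun y => p.prob_real_extinctionEvent univ y

lemma antitone_extinctionEvent (y : TypeSet d) : Antitone (extinctionEvent y) :=
  fun _ _ hAB _ ⟨n, hn⟩ => ⟨n, fun m hm j hj => hn m hm j (hAB hj)⟩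

lemma tendsto_extinction_lowLevels :
    Tendsto (fun k => p.toKernel.extinction (lowLevels d k)) atTop (𝓝 p.partialExtinction) := by
  refine tendsto_pi_nhds.2 fun y => ?_
  simp only [← prob_real_extinctionEvent]
  exact (ENNReal.tendsto_toReal (measure_ne_top _ _)).comp (tendsto_measure_iInter_atTop
    (fun k => (FamilyTree.measurableSet_extinctionEvent _ y).nullMeasurableSet)
    ((antitone_extinctionEvent y).comp_monotone monotone_lowLevels) ⟨0, measure_ne_top _ _⟩)

lemma partialExtinction_le_extinction_lowLevels (k : ℕ) :
    p.partialExtinction ≤ p.toKernel.extinction (lowLevels d k) := fun y => by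
  rw [← prob_real_extinctionEvent]
  exact measureReal_mono (iInter_subset _ k)

lemma globalExtinction_le_partialExtinction : p.globalExtinction ≤ p.partialExtinction :=
  fun y => measureReal_mono
    (subset_iInter fun _ => antitone_extinctionEvent y (subset_univ _))

lemma isLeast_globalExtinction : IsLeast p.fixedPoints p.globalExtinction := by
  rw [globalExtinction_eq_extinction_univ]
  refine ⟨p.mem_fixedPoints.2 ⟨p.toKernel.extinction_mem_Icc _, p.toKernel.gf_extinction _⟩,
    fun s hs => ?_⟩
  rw [mem_fixedPoints] at hs
  exact p.toKernel.extinction_univ_le hs.1 hs.2.le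

lemma partialExtinction_mem_fixedPoints : p.partialExtinction ∈ p.fixedPoints := by
  have hmem : ∀ k, p.toKernel.extinction (lowLevels d k) ∈ Icc 0 1 :=
    fun k => p.toKernel.extinction_mem_Icc _
  have hpartial : p.partialExtinction ∈ Icc 0 1 :=
    isClosed_Icc.mem_of_tendsto p.tendsto_extinction_lowLevels (Eventually.of_forall hmem)
  refine p.mem_fixedPoints.2 ⟨hpartial, tendsto_nhds_unique ?_ p.tendsto_extinction_lowLevels⟩
  have hgf := (p.toKernel.isGeneratingOperator_gf.continuousOn _ hpartial).tendsto.comp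
    (tendsto_nhdsWithin_iff.2 ⟨p.tendsto_extinction_lowLevels, Eventually.of_forall hmem⟩)
  refine hgf.congr fun k => ?_
  exact p.toKernel.gf_extinction _

lemma exists_mem_fixedPoints_apply_eq (y : TypeSet d) {v : ℝ} (hq : p.globalExtinction y ≤ v)
    (hv : v ≤ p.partialExtinction y) : ∃ s ∈ p.fixedPoints, s y = v := by
  rw [globalExtinction_eq_extinction_univ] at hq
  obtain ⟨s, hs, hfix, hsy⟩ := p.toKernel.exists_gf_eq_self_apply_eq (l := atTop)
    (fun x => eventually_ge_atTop x.1) y hq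
    fun k => hv.trans (p.partialExtinction_le_extinction_lowLevels k y)
  exact ⟨s, p.mem_fixedPoints.2 ⟨hs, hfix⟩, hsy⟩

end Extinction

namespace Irreducible

variable {p}

lemma le_partialExtinction [NeZero d] (hp : p.Irreducible) (hns : ¬ p.Singular)
    (hs : s ∈ p.fixedPoints) (hne : s ≠ 1) : s ≤ p.partialExtinction := by
  obtain ⟨hsI, hfix⟩ := p.mem_fixedPoints.1 hs
  exact ge_of_tendsto' p.tendsto_extinction_lowLevels fun k =>
    hp.isIrreducible.le_extinction hns (finite_lowLevels k) (nonempty_lowLevels k) hsI hfix.ge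
      (hp.isIrreducible.lt_one hsI hfix hne)

lemma isLUB_one (hp : p.Irreducible) (h1 : p.partialExtinction = 1)
    (hne : (p.fixedPoints \ {1}).Nonempty) : IsLUB (p.fixedPoints \ {1}) 1 := by
  refine ⟨fun s hs => (p.mem_fixedPoints.1 hs.1).1.2, fun b hb y => le_of_forall_lt fun c hc => ?_⟩
  obtain ⟨s₀, hs₀, hs₀1⟩ := hne
  obtain ⟨hs₀I, hfix₀⟩ := p.mem_fixedPoints.1 hs₀
  have hq : p.globalExtinction y < 1 :=
    (p.isLeast_globalExtinction.2 hs₀ y).trans_lt (hp.isIrreducible.lt_one hs₀I hfix₀ hs₀1 y)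
  obtain ⟨v, hv, hv1⟩ := exists_between (max_lt hc hq)
  obtain ⟨s, hs, hsy⟩ := p.exists_mem_fixedPoints_apply_eq y ((le_max_right _ _).trans hv.le)
    (h1 ▸ hv1.le)
  have hs1 : s ≠ 1 := fun h => hv1.ne (by rw [← hsy, h, Pi.one_apply])
  exact ((le_max_left _ _).trans_lt hv).trans_le (hsy ▸ hb ⟨hs, hs1⟩ y)

lemma isLUB_partialExtinction [NeZero d] (hp : p.Irreducible)
    (h : ¬ p.Singular ∨ p.partialExtinction = 1) (hne : (p.fixedPoints \ {1}).Nonempty) :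
    IsLUB (p.fixedPoints \ {1}) p.partialExtinction := by
  by_cases h1 : p.partialExtinction = 1
  · rw [h1]
    exact hp.isLUB_one h1 hne
  · have hgreatest : IsGreatest (p.fixedPoints \ {1}) p.partialExtinction :=
      ⟨⟨p.partialExtinction_mem_fixedPoints, h1⟩,
        fun s hs => hp.le_partialExtinction (h.resolve_right h1) hs.1 hs.2⟩
    exact hgreatest.isLUB

end Irreducible

namespace LocallyIsomorphic

/-- Forgetting the phase: a type of a block process is mapped to the corresponding type of an
associated single-phase process. -/
def toLevel (x : TypeSet d) : TypeSet 1 := (x.1, 0)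

variable {p} {phat : BlockLHBP 1}

lemma mapDomain_toLevel_apply (r : OffspringVec d) (l : ℕ) :
    r.mapDomain toLevel (l, 0) = ∑ a : Fin d, r (l, a) := by
  induction r using Finsupp.induction_linear with
  | zero => simp
  | add r r' hr hr' =>
    simp only [Finsupp.mapDomain_add, Finsupp.add_apply, hr, hr', Finset.sum_add_distrib]
  | single x n =>
    obtain ⟨k, i⟩ := x
    by_cases hk : k = l <;> simp [toLevel, Finsupp.single_apply, hk]

lemma mapDomain_toLevel_eq_iff (r : OffspringVec d) (u : OffspringVec 1) :
    r.mapDomain toLevel = u ↔ ∀ l : ℕ, ∑ a : Fin d, r (l, a) = u (l, 0) := by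
  simp only [Finsupp.ext_iff, Prod.forall, Fin.forall_fin_one, mapDomain_toLevel_apply]

lemma isLumping (hiso : p.LocallyIsomorphic phat) :
    OffspringKernel.IsLumping p.toKernel phat.toKernel toLevel := by
  rintro ⟨k, i⟩
  ext u
  rw [toLevel, hiso k i u, PMF.map_apply]
  refine (tsum_subtype {r : OffspringVec d | _} (p.law (k, i))).trans (tsum_congr fun r => ?_)
  simp only [indicator_apply, mem_ofPred_eq, ← mapDomain_toLevel_eq_iff, eq_comm (a := u)]

lemma globalExtinction_eq_comp (hiso : p.LocallyIsomorphic phat) :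
    p.globalExtinction = phat.globalExtinction ∘ toLevel := by
  rw [globalExtinction_eq_extinction_univ, globalExtinction_eq_extinction_univ,
    ← hiso.isLumping.extinction_preimage, preimage_univ]

lemma partialExtinction_eq_comp (hiso : p.LocallyIsomorphic phat) :
    p.partialExtinction = phat.partialExtinction ∘ toLevel := by
  have hlow : ∀ k, p.toKernel.extinction (lowLevels d k) =
      phat.toKernel.extinction (lowLevels 1 k) ∘ toLevel :=
    fun k => hiso.isLumping.extinction_preimage (lowLevels 1 k)
  refine tendsto_nhds_unique p.tendsto_extinction_lowLevels (tendsto_pi_nhds.2 fun x => ?_)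
  simp only [hlow]
  exact tendsto_pi_nhds.1 phat.tendsto_extinction_lowLevels _

lemma singular [NeZero d] (hiso : p.LocallyIsomorphic phat) (h : p.Singular) : phat.Singular :=
  hiso.isLumping.isSingular (fun ⟨k, i⟩ => ⟨(k, 0), by rw [Subsingleton.elim i 0]; rfl⟩) h

lemma comp_toLevel_mem_fixedPoints (hiso : p.LocallyIsomorphic phat) {s : TypeSet 1 → ℝ}
    (hs : s ∈ phat.fixedPoints) : s ∘ toLevel ∈ p.fixedPoints := by
  obtain ⟨hsI, hfix⟩ := phat.mem_fixedPoints.1 hs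
  refine p.mem_fixedPoints.2 ⟨⟨fun x => hsI.1 _, fun x => hsI.2 _⟩, ?_⟩
  rw [hiso.isLumping.gf_comp hsI, hfix]

lemma const_mem_levelProjection (hiso : p.LocallyIsomorphic phat) (k : ℕ) {v : ℝ}
    (hv : v ∈ Icc (phat.globalExtinction (k, 0)) (phat.partialExtinction (k, 0))) :
    (fun _ => v) ∈ p.levelProjection k := by
  obtain ⟨s, hs, rfl⟩ := phat.exists_mem_fixedPoints_apply_eq (k, 0) hv.1 hv.2
  exact ⟨fun _ => hs.1 _, _, hiso.comp_toLevel_mem_fixedPoints hs, fun _ => rfl⟩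

end LocallyIsomorphic

end BlockLHBP

end

theorem mainTheorem9_general {d : ℕ} [NeZero d] (p : BlockLHBP d) (phat : BlockLHBP 1)
    (hiso : p.LocallyIsomorphic phat) :
    IsLeast p.fixedPoints p.globalExtinction ∧
    (p.Irreducible → (¬ phat.Singular ∨ p.partialExtinction = 1) →
      (p.fixedPoints \ {1}).Nonempty →
      IsLUB (p.fixedPoints \ {1}) p.partialExtinction) ∧
    (∀ (k : ℕ) (i : Fin d), p.globalExtinction (k, i) = p.globalExtinction (k, 0)) ∧
    (∀ (k : ℕ) (i : Fin d), p.partialExtinction (k, i) = p.partialExtinction (k, 0)) ∧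
    (∀ (k : ℕ), ∀ x ∈ Set.Icc (0 : ℝ) 1,
      (fun _ : Fin d => x * p.globalExtinction (k, 0) + (1 - x) * p.partialExtinction (k, 0))
        ∈ p.levelProjection k) := by
  have hq := hiso.globalExtinction_eq_comp
  have hqt := hiso.partialExtinction_eq_comp
  refine ⟨p.isLeast_globalExtinction, fun hp hor hne => ?_, fun k i => by rw [hq]; rfl,
    fun k i => by rw [hqt]; rfl, fun k x hx => hiso.const_mem_levelProjection k ?_⟩
  · exact hp.isLUB_partialExtinction (hor.imp_left (mt hiso.singular)) hne
  · rw [hq, hqt]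
    have hle := phat.globalExtinction_le_partialExtinction (k, 0)
    exact convex_Icc _ _ (Set.left_mem_Icc.2 hle) (Set.right_mem_Icc.2 hle) hx.1
      (sub_nonneg.2 hx.2) (by ring)

theorem mainTheorem9 {d : ℕ} [NeZero d] (p : BlockLHBP d) (phat : BlockLHBP 1)
    (hiso : p.LocallyIsomorphic phat) (hirr : phat.Irreducible) :
    IsLeast p.fixedPoints p.globalExtinction ∧
    (p.Irreducible → (¬ phat.Singular ∨ p.partialExtinction = 1) →
      (p.fixedPoints \ {1}).Nonempty →
      IsLUB (p.fixedPoints \ {1}) p.partialExtinction) ∧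
    (∀ (k : ℕ) (i : Fin d), p.globalExtinction (k, i) = p.globalExtinction (k, 0)) ∧
    (∀ (k : ℕ) (i : Fin d), p.partialExtinction (k, i) = p.partialExtinction (k, 0)) ∧
    (∀ (k : ℕ), ∀ x ∈ Set.Icc (0 : ℝ) 1,
      (fun _ : Fin d => x * p.globalExtinction (k, 0) + (1 - x) * p.partialExtinction (k, 0))
        ∈ p.levelProjection k) :=
  mainTheorem9_general p phat hiso
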